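/- Let $\mathcal H_A,\mathcal H_B$ be complex Hilbert spaces and $\mathcal H_A\otimes\mathcal H_B$ their Hilbert space tensor product. A measuring operation (instrument) is a family $I=\{I_\omega\}$ of completely positive maps on trace class operators whose sum $\sum_\omega I_\omega$ is trace preserving; a quantum operation is a trace preserving completely positive map. An instrument is \emph{with LOCC} if it is implemented by finitely many rounds, in each of which one of the two parties performs an instrument on the local system of that party (which may be replaced by another one, so that ancillas are allowed; at most countably many outcomes), depending on the classical outcomes obtained so far, and communicates the outcome to the other party; at the end both parties apply local quantum operations, and the measured value $\omega$ is a function of the classical record, operations with the same value $\omega$ being added. A quantum operation is with LOCC if it is an LOCC instrument with a single measured value. \textbf{Lemma (generalization of Lo--Popescu).} Let $I=\{I_\omega\}$ be a measuring operation with LOCC on $\mathcal H_A\otimes\mathcal H_B$ and let $\Phi\in\mathcal H_A\otimes\mathcal H_B$ be a unit vector. Then there exist a POVM $\{M_\omega\}$ on $\mathcal H_A$ (every $M_\omega$ is a positive bounded operator and $\sum_\omega M_\omega$ is the identity) and quantum operations $C_\omega$ with LOCC on $\mathcal H_A\otimes\mathcal H_B$ such that $$I_\omega(|\Phi\rangle\langle\Phi|)=C_\omega\Big((\sqrt{M_\omega}\otimes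 \mathrm{id})\,|\Phi\rangle\langle\Phi|\,(\sqrt{M_\omega}\otimes \mathrm{id})\Big)\qquad\text{for all }\omega .$$ -/

import Mathlib

open scoped TensorProduct ComplexOrder

noncomputable section

namespace LOCC

universe u v w

/-! ### Trace class operators, states, operations and instruments -/

section Basic

variable (H : Type u) [NormedAddCommGroup H] [InnerProductSpace ℂ H] [CompleteSpace H]

/-- Index set of a fixed orthonormal (Hilbert) basis of the Hilbert space `H`. -/
def basisIndex : Set H := (exists_hilbertBasis ℂ H).choose

/-- A fixed orthonormal (Hilbert) basis of the Hilbert space `H`. -/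
def basis : HilbertBasis (basisIndex H) ℂ H := (exists_hilbertBasis ℂ H).choose_spec.choose

/-- The space of trace class operators on `H`: the linear span of the positive bounded operators
`T` with `∑ i, ⟪e i, T (e i)⟫ < ∞` for an orthonormal basis `e`. -/
def traceClass : Submodule ℂ (H →L[ℂ] H) :=
  Submodule.span ℂ
    {T | T.IsPositive ∧ Summable fun i => inner ℂ (basis H i) (T (basis H i))}

variable {H}

/-- The trace of a trace class operator. -/
def trace (T : traceClass H) : ℂ := ∑' i, inner ℂ (basis H i) (T.1 (basis H i))

/-- The rank one operator `|x⟩⟨x|` is of trace class. -/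
theorem ketbra_mem_traceClass (x : H) : InnerProductSpace.rankOne ℂ x x ∈ traceClass H := by
  refine Submodule.subset_span ⟨?_, ?_⟩
  · exact InnerProductSpace.isPositive_rankOne_self x
  · have h := (basis H).summable_inner_mul_inner x x
    refine h.congr fun i => ?_
    simp [InnerProductSpace.rankOne_apply]

/-- The operator `|x⟩⟨x|`; for a unit vector `x` this is the pure state with state vector `x`. -/
def ketbra (x : H) : traceClass H := ⟨InnerProductSpace.rankOne ℂ x x, ketbra_mem_traceClass x⟩

end Basic

section Operations

variable {H : Type u} [NormedAddCommGroup H] [InnerProductSpace ℂ H] [CompleteSpace H]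
variable {K : Type v} [NormedAddCommGroup K] [InnerProductSpace ℂ K] [CompleteSpace K]

/-- `S |x⟩⟨x| S* = |S x⟩⟨S x|`. -/
theorem ketbra_map (S : H →L[ℂ] K) (x : H) :
    (ketbra (S x)).1 = S ∘L (ketbra x).1 ∘L ContinuousLinearMap.adjoint S := by
  ext y
  simp [ketbra, InnerProductSpace.rankOne_apply, ContinuousLinearMap.adjoint_inner_right]

/-- An `n × n` matrix of trace class operators on `H` is positive if it is positive as an operator
on the direct sum of `n` copies of `H`, that is, on `ℂⁿ ⊗ H`. -/
def BlockPositive {n : ℕ} (ρ : Matrix (Fin n) (Fin n) (traceClass H)) : Prop :=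
  ∀ ξ : Fin n → H, 0 ≤ ∑ i, ∑ j, inner ℂ (ξ i) ((ρ i j).1 (ξ j))

variable (H K) in
/-- Linear maps from the trace class operators on `H` to those on `K`. -/
abbrev Op := traceClass H →ₗ[ℂ] traceClass K

/-- Complete positivity: `id ⊗ E` maps positive operators on `ℂⁿ ⊗ H` to positive operators on
`ℂⁿ ⊗ K`, for every `n`. -/
def IsCP (E : Op H K) : Prop :=
  ∀ (n : ℕ) (ρ : Matrix (Fin n) (Fin n) (traceClass H)),
    BlockPositive ρ → BlockPositive fun i j => E (ρ i j)

/-- A measuring operation (instrument): a family of completely positive maps whose sum is trace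
preserving. -/
def IsInstrument {Ω : Type w} (I : Ω → Op H K) : Prop :=
  (∀ ω, IsCP (I ω)) ∧ ∀ ρ : traceClass H, HasSum (fun ω => trace (I ω ρ)) (trace ρ)

/-- A quantum operation: a trace preserving completely positive map. -/
def IsTPCP (E : Op H K) : Prop :=
  IsCP E ∧ ∀ ρ : traceClass H, trace (E ρ) = trace ρ

/-- A POVM: a family of positive operators whose sum (in the strong operator topology) is the
identity. -/
def IsPOVM {Ω : Type w} (M : Ω → H →L[ℂ] H) : Prop :=
  (∀ ω, (M ω).IsPositive) ∧ ∀ x : H, HasSum (fun ω => M ω x) x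

end Operations

/-! ### Bipartite systems -/

section Bipartite

/-- The Hilbert space tensor product `A ⊗ B` (the completion of the algebraic one). -/
abbrev HTensor (A : Type u) (B : Type v) [NormedAddCommGroup A] [InnerProductSpace ℂ A]
    [NormedAddCommGroup B] [InnerProductSpace ℂ B] :=
  UniformSpace.Completion (A ⊗[ℂ] B)

variable {A A' : Type u} {B B' : Type v}
variable [NormedAddCommGroup A] [InnerProductSpace ℂ A]
variable [NormedAddCommGroup B] [InnerProductSpace ℂ B]
variable [NormedAddCommGroup A'] [InnerProductSpace ℂ A']
variable [NormedAddCommGroup B'] [InnerProductSpace ℂ B']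

/-- The product vector `a ⊗ b`. -/
def tens (a : A) (b : B) : HTensor A B := ((a ⊗ₜ[ℂ] b : A ⊗[ℂ] B) : HTensor A B)

/-- The tensor product `X ⊗ Y` of two bounded operators, `(X ⊗ Y)(a ⊗ b) = X a ⊗ Y b`. -/
def opTensor (X : A →L[ℂ] A') (Y : B →L[ℂ] B') : HTensor A B →L[ℂ] HTensor A' B' :=
  (TensorProduct.mapL X Y).completion

variable [CompleteSpace A] [CompleteSpace B] [CompleteSpace A'] [CompleteSpace B']

/-- `F` is the tensor product `E ⊗ G` of the maps `E` (on Alice's side) and `G` (on Bob's side):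
the completely positive map with `F (|a⟩⟨a| ⊗ |b⟩⟨b|) = E (|a⟩⟨a|) ⊗ G (|b⟩⟨b|)`.
By linearity and polarization this fixes `F` on all operators `|a⟩⟨a'| ⊗ |b⟩⟨b'|`; as positive
maps are continuous in the trace norm, it fixes `F`. -/
def IsTensorOp (F : Op (HTensor A B) (HTensor A' B')) (E : Op A A') (G : Op B B') : Prop :=
  IsCP F ∧ ∀ (a : A) (b : B),
    (F (ketbra (tens a b))).1 = opTensor (E (ketbra a)).1 (G (ketbra b)).1

/-- The instrument `F = (F k)` on the bipartite system is the instrument `J = (J k)` performed by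
Alice on her system, Bob doing nothing: `F k = J k ⊗ id`. -/
def IsLocalAlice (F : ℕ → Op (HTensor A B) (HTensor A' B)) : Prop :=
  IsInstrument F ∧ ∃ J : ℕ → Op A A', IsInstrument J ∧ ∀ k, IsTensorOp (F k) (J k) LinearMap.id

/-- The instrument `F = (F k)` on the bipartite system is the instrument `J = (J k)` performed by
Bob on his system, Alice doing nothing: `F k = id ⊗ J k`. -/
def IsLocalBob (F : ℕ → Op (HTensor A B) (HTensor A B')) : Prop :=
  IsInstrument F ∧ ∃ J : ℕ → Op B B', IsInstrument J ∧ ∀ k, IsTensorOp (F k) LinearMap.id (J k)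

end Bipartite

/-! ### LOCC -/

section Protocols

variable {Ω : Type w} (A' : Type u) (B' : Type v)
variable [NormedAddCommGroup A'] [InnerProductSpace ℂ A'] [CompleteSpace A']
variable [NormedAddCommGroup B'] [InnerProductSpace ℂ B'] [CompleteSpace B']

/-- `IsLOCCRounds A' B' n A B I` means that the family `I` of operations from `A ⊗ B` to `A' ⊗ B'`
is implemented by local operations and `n` rounds of classical communication.

* With no round left, Alice and Bob apply local quantum operations, and the measured value is
  a fixed `ω₀` (which is determined by the classical record of the preceding rounds).
* Otherwise one of the two parties performs an instrument `F` on the system of that party, which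
  may change this system (so that it may contain ancillas), and sends the outcome `k` to the
  other party; then they follow a protocol `P k` with one round less, which depends on `k`.
  Outcomes are numbered by natural numbers (finitely many outcomes: `F k = 0` for the other `k`).

Different classical records may lead to the same `ω`; the corresponding operations are added up
(the sums are of positive operators for positive `ρ`, and converge). -/
def IsLOCCRounds : (n : ℕ) → (A : Type u) → (B : Type v) →
    [NormedAddCommGroup A] → [InnerProductSpace ℂ A] → [CompleteSpace A] →
    [NormedAddCommGroup B] → [InnerProductSpace ℂ B] → [CompleteSpace B] →
    (Ω → Op (HTensor A B) (HTensor A' B')) → Prop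
  | 0, A, B, _, _, _, _, _, _, I =>
      ∃ (ω₀ : Ω) (E : Op A A') (G : Op B B'), IsTPCP E ∧ IsTPCP G ∧
        IsTPCP (I ω₀) ∧ IsTensorOp (I ω₀) E G ∧ ∀ ω, ω ≠ ω₀ → I ω = 0
  | n + 1, A, B, _, _, _, _, _, _, I =>
      (∃ (A₁ : Type u) (_ : NormedAddCommGroup A₁) (_ : InnerProductSpace ℂ A₁)
        (_ : CompleteSpace A₁)
        (F : ℕ → Op (HTensor A B) (HTensor A₁ B))
        (P : ℕ → Ω → Op (HTensor A₁ B) (HTensor A' B')),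
        IsLocalAlice F ∧ (∀ k, IsLOCCRounds n A₁ B (P k)) ∧
        ∀ ω ρ, HasSum (fun k => (P k ω (F k ρ)).1) (I ω ρ).1) ∨
      (∃ (B₁ : Type v) (_ : NormedAddCommGroup B₁) (_ : InnerProductSpace ℂ B₁)
        (_ : CompleteSpace B₁)
        (F : ℕ → Op (HTensor A B) (HTensor A B₁))
        (P : ℕ → Ω → Op (HTensor A B₁) (HTensor A' B')),
        IsLocalBob F ∧ (∀ k, IsLOCCRounds n A B₁ (P k)) ∧
        ∀ ω ρ, HasSum (fun k => (P k ω (F k ρ)).1) (I ω ρ).1)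

variable {A' B'} {A : Type u} {B : Type v}
variable [NormedAddCommGroup A] [InnerProductSpace ℂ A] [CompleteSpace A]
variable [NormedAddCommGroup B] [InnerProductSpace ℂ B] [CompleteSpace B]

/-- A measuring operation with LOCC: an instrument implemented by local operations and finitely
many rounds of classical communication. -/
def IsLOCCInstrument (I : Ω → Op (HTensor A B) (HTensor A' B')) : Prop :=
  IsInstrument I ∧ ∃ n, IsLOCCRounds A' B' n A B I

/-- A quantum operation with LOCC: an LOCC measuring operation with a single measured value. -/
def IsLOCCOperation (C : Op (HTensor A B) (HTensor A' B')) : Prop :=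
  IsTPCP C ∧ ∃ n, IsLOCCRounds A' B' n A B fun _ : Unit => C

end Protocols

end LOCC

end

open LOCC

/-!
Let a party perform an instrument `F` on the pure state `x`, and decompose every `F k (|x⟩⟨x|)` into
rank one operators `|ψ⟩⟨ψ|`. Since the other party's reduced state does not change (no signalling),
Douglas' lemma yields Kraus operators `K i` on the acting party's system with `(K i ⊗ 1) x = ψ i`,
so that on `x` the instrument acts like a measurement of this party which leaves the state pure. If
the acting party is Bob, polar decompositions turn `(1 ⊗ K i) x` into `(N i ⊗ V i) x` with
contractions `V i` of Bob and Kraus operators `N i` of Alice (Lo–Popescu): Alice can measure in his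
place and announce the outcome, after which Bob applies `V i`. Consecutive measurements of Alice
merge into a single one, the remaining randomness being regenerated by her after the measurement.
By induction on the number of rounds Alice needs just one measurement, at the very beginning, and it
remains to complete its Kraus operators to the square roots of a POVM.
-/

noncomputable section

namespace LOCC

open scoped ENNReal NNReal
open ContinuousLinearMap (adjoint)

section Trace

variable {H : Type*} [NormedAddCommGroup H] [InnerProductSpace ℂ H]

section ENorm

variable {E F : Type*} [SeminormedAddCommGroup E] [SeminormedAddCommGroup F]

theorem enorm_sq_eq_ofReal (x : E) : ‖x‖ₑ ^ 2 = ENNReal.ofReal (‖x‖ ^ 2) := by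
  rw [← ofReal_norm, ENNReal.ofReal_pow (norm_nonneg x)]

theorem enorm_sq_ne_top (x : E) : ‖x‖ₑ ^ 2 ≠ ∞ :=
  ENNReal.pow_ne_top enorm_ne_top

theorem enorm_sq_le_enorm_sq_iff {x : E} {y : F} : ‖x‖ₑ ^ 2 ≤ ‖y‖ₑ ^ 2 ↔ ‖x‖ ≤ ‖y‖ := by
  rw [ENNReal.pow_le_pow_left_iff two_ne_zero, enorm_le_iff_norm_le]

theorem enorm_sq_eq_enorm_sq_iff {x : E} {y : F} : ‖x‖ₑ ^ 2 = ‖y‖ₑ ^ 2 ↔ ‖x‖ = ‖y‖ := by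
  simp only [le_antisymm_iff, enorm_sq_le_enorm_sq_iff]

end ENorm

theorem enorm_inner_le (x y : H) : ‖inner ℂ x y‖ₑ ≤ ‖x‖ₑ * ‖y‖ₑ := by
  rw [← ofReal_norm, ← ofReal_norm, ← ofReal_norm, ← ENNReal.ofReal_mul (norm_nonneg _)]
  exact ENNReal.ofReal_le_ofReal (norm_inner_le_norm x y)

theorem tsum_enorm_inner_sq {ι : Type*} (b : HilbertBasis ι ℂ H) (x : H) :
    ∑' i, ‖inner ℂ (b i) x‖ₑ ^ 2 = ‖x‖ₑ ^ 2 := by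
  have parseval : HasSum (fun i => ‖inner ℂ (b i) x‖ ^ 2) (‖x‖ ^ 2) := by
    convert Complex.hasSum_re (b.hasSum_inner_mul_inner x x) using 1
    · ext i
      rw [← RCLike.re_eq_complex_re, inner_mul_symm_re_eq_norm, norm_mul, norm_inner_symm x, sq]
    · rw [inner_self_eq_norm_sq_to_K]
      norm_cast
  simp only [enorm_sq_eq_ofReal]
  rw [← parseval.tsum_eq, ENNReal.ofReal_tsum_of_nonneg (fun i => by positivity) parseval.summable]

theorem isPositive_of_inner_nonneg {T : H →L[ℂ] H} (h : ∀ x, 0 ≤ inner ℂ x (T x)) :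
    T.IsPositive := by
  refine (ContinuousLinearMap.isPositive_iff_complex T).2 fun x => ?_
  rw [← inner_conj_symm, Complex.eq_coe_norm_of_nonneg (h x), Complex.conj_ofReal]
  simp

/-- The quadratic form `⟪x, T x⟫` of a positive operator, as an element of `[0, ∞]`. -/
def quadForm (T : H →L[ℂ] H) (x : H) : ℝ≥0∞ := ENNReal.ofReal (inner ℂ x (T x)).re

/-- The vectors `ψ i` decompose `T` into rank one operators: `T = ∑ i, |ψ i⟩⟨ψ i|`, encoded as an
identity of quadratic forms. -/
def IsDecomposition {ι : Type*} (T : H →L[ℂ] H) (ψ : ι → H) : Prop :=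
  ∀ x, ∑' i, ‖inner ℂ (ψ i) x‖ₑ ^ 2 = quadForm T x

theorem quadForm_ne_top (T : H →L[ℂ] H) (x : H) : quadForm T x ≠ ∞ := ENNReal.ofReal_ne_top

theorem inner_eq_quadForm {T : H →L[ℂ] H} (hT : T.IsPositive) (x : H) :
    inner ℂ x (T x) = ((quadForm T x).toReal : ℂ) := by
  have h := hT.inner_nonneg_right x
  rw [quadForm, ENNReal.toReal_ofReal (Complex.nonneg_iff.1 h).1]
  exact Complex.eq_re_of_ofReal_le h

theorem quadForm_eq_tsum {ι : Type*} {T : ι → H →L[ℂ] H} (hT : ∀ i, (T i).IsPositive)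
    {S : H →L[ℂ] H} {x : H} (h : HasSum (fun i => T i x) (S x)) :
    quadForm S x = ∑' i, quadForm (T i) x := by
  have hre : HasSum (fun i => (inner ℂ x (T i x)).re) (inner ℂ x (S x)).re :=
    Complex.hasSum_re (h.mapL (innerSL ℂ x))
  rw [quadForm, ← hre.tsum_eq]
  exact ENNReal.ofReal_tsum_of_nonneg (fun i => (hT i).re_inner_nonneg_right x) hre.summable

theorem isDecomposition_rankOne (x : H) :
    IsDecomposition (InnerProductSpace.rankOne ℂ x x) fun _ : Unit => x := by
  intro y
  rw [tsum_fintype, Fintype.sum_unique, quadForm, InnerProductSpace.rankOne_apply,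
    inner_smul_right, ← RCLike.re_eq_complex_re, inner_mul_symm_re_eq_norm, norm_mul,
    norm_inner_symm y, ← sq, enorm_sq_eq_ofReal]

variable [CompleteSpace H]

theorem isPositive_of_hasSum {ι : Type*} {T : ι → H →L[ℂ] H} {S : H →L[ℂ] H} (h : HasSum T S)
    (hT : ∀ i, (T i).IsPositive) : S.IsPositive := by
  simp only [← ContinuousLinearMap.nonneg_iff_isPositive] at hT ⊢
  exact h.nonneg hT

theorem isPositive_sqrt (T : H →L[ℂ] H) : (CFC.sqrt T).IsPositive :=
  (ContinuousLinearMap.nonneg_iff_isPositive _).1 (CFC.sqrt_nonneg T)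

theorem sqrt_comp_sqrt {T : H →L[ℂ] H} (hT : T.IsPositive) : CFC.sqrt T ∘L CFC.sqrt T = T :=
  CFC.sqrt_mul_sqrt_self T ((ContinuousLinearMap.nonneg_iff_isPositive T).2 hT)

theorem quadForm_eq_enorm_sqrt_sq {T : H →L[ℂ] H} (hT : T.IsPositive) (x : H) :
    quadForm T x = ‖CFC.sqrt T x‖ₑ ^ 2 := by
  conv_lhs => rw [quadForm, ← sqrt_comp_sqrt hT]
  rw [ContinuousLinearMap.comp_apply, ← (isPositive_sqrt T).inner_left_eq_inner_right,
    inner_self_eq_norm_sq_to_K, enorm_sq_eq_ofReal]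
  norm_cast

theorem isDecomposition_sqrt {T : H →L[ℂ] H} (hT : T.IsPositive) :
    IsDecomposition T fun i => CFC.sqrt T (basis H i) := fun x => by
  simp only [(isPositive_sqrt T).inner_left_eq_inner_right, tsum_enorm_inner_sq,
    quadForm_eq_enorm_sqrt_sq hT]

theorem IsDecomposition.conj {ι K : Type*} [NormedAddCommGroup K] [InnerProductSpace ℂ K]
    [CompleteSpace K] {T : H →L[ℂ] H} {ψ : ι → H} (h : IsDecomposition T ψ) (S : H →L[ℂ] K) :
    IsDecomposition (S ∘L T ∘L adjoint S) fun i => S (ψ i) := fun x => by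
  rw [quadForm, ContinuousLinearMap.comp_apply, ← ContinuousLinearMap.adjoint_inner_left]
  simp only [← ContinuousLinearMap.adjoint_inner_right S]
  exact h (adjoint S x)

/-- The trace of a positive operator, as an element of `[0, ∞]`; it is finite exactly for the
positive operators of trace class. -/
def eTrace (T : H →L[ℂ] H) : ℝ≥0∞ := ∑' i, quadForm T (basis H i)

theorem IsDecomposition.eTrace_eq {ι : Type*} {T : H →L[ℂ] H} {ψ : ι → H}
    (h : IsDecomposition T ψ) : eTrace T = ∑' i, ‖ψ i‖ₑ ^ 2 := by
  simp only [eTrace, ← h _, ← tsum_enorm_inner_sq (basis H) (ψ _)]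
  rw [ENNReal.tsum_comm]
  refine tsum_congr fun i => tsum_congr fun j => ?_
  rw [← inner_conj_symm, RCLike.enorm_conj]

theorem eTrace_eq_tsum {ι : Type*} {T : ι → H →L[ℂ] H} {S : H →L[ℂ] H} (h : HasSum T S)
    (hT : ∀ i, (T i).IsPositive) : eTrace S = ∑' i, eTrace (T i) := by
  have quadForm_eq x : quadForm S x = ∑' i, quadForm (T i) x :=
    quadForm_eq_tsum hT (h.mapL (ContinuousLinearMap.apply ℂ H x))
  simp only [eTrace, quadForm_eq]
  exact ENNReal.tsum_comm

theorem tsum_enorm_map_sq_le {ι E F : Type*} [NormedAddCommGroup E] [NormedSpace ℂ E]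
    [NormedAddCommGroup F] [NormedSpace ℂ F] (S : E →L[ℂ] F) (ψ : ι → E) :
    ∑' i, ‖S (ψ i)‖ₑ ^ 2 ≤ ‖S‖ₑ ^ 2 * ∑' i, ‖ψ i‖ₑ ^ 2 := by
  rw [← ENNReal.tsum_mul_left]
  refine ENNReal.tsum_le_tsum fun i => ?_
  rw [← mul_pow]
  gcongr
  exact S.le_opENorm _

theorem eTrace_conj_le {K : Type*} [NormedAddCommGroup K] [InnerProductSpace ℂ K]
    [CompleteSpace K] {T : H →L[ℂ] H} (hT : T.IsPositive) (S : H →L[ℂ] K) :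
    eTrace (S ∘L T ∘L adjoint S) ≤ ‖S‖ₑ ^ 2 * eTrace T := by
  rw [(isDecomposition_sqrt hT).eTrace_eq, ((isDecomposition_sqrt hT).conj S).eTrace_eq]
  exact tsum_enorm_map_sq_le S _

theorem quadForm_le_eTrace_mul {T : H →L[ℂ] H} (hT : T.IsPositive) (x : H) :
    quadForm T x ≤ eTrace T * ‖x‖ₑ ^ 2 := by
  rw [← isDecomposition_sqrt hT x, (isDecomposition_sqrt hT).eTrace_eq, ← ENNReal.tsum_mul_right]
  refine ENNReal.tsum_le_tsum fun i => ?_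
  rw [← mul_pow]
  gcongr
  exact enorm_inner_le _ _

theorem enorm_le_eTrace {T : H →L[ℂ] H} (hT : T.IsPositive) : ‖T‖ₑ ≤ eTrace T := by
  obtain hT_top | hT_top := eq_or_ne (eTrace T) ∞
  · simp [hT_top]
  have norm_sqrt_le : ‖CFC.sqrt T‖ ≤ √(eTrace T).toReal := by
    refine ContinuousLinearMap.opNorm_le_bound _ (Real.sqrt_nonneg _) fun x => ?_
    refine (sq_le_sq₀ (norm_nonneg _) (by positivity)).1 ?_
    have h := quadForm_le_eTrace_mul hT x
    rw [quadForm_eq_enorm_sqrt_sq hT, enorm_sq_eq_ofReal, enorm_sq_eq_ofReal,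
      ← ENNReal.ofReal_toReal hT_top, ← ENNReal.ofReal_mul ENNReal.toReal_nonneg,
      ENNReal.ofReal_le_ofReal_iff (by positivity)] at h
    rwa [mul_pow, Real.sq_sqrt ENNReal.toReal_nonneg]
  have norm_le : ‖T‖ ≤ (eTrace T).toReal := calc
    ‖T‖ ≤ ‖CFC.sqrt T‖ * ‖CFC.sqrt T‖ :=
      (congrArg norm (sqrt_comp_sqrt hT)).ge.trans (ContinuousLinearMap.opNorm_comp_le _ _)
    _ ≤ √(eTrace T).toReal * √(eTrace T).toReal := by gcongr
    _ = (eTrace T).toReal := Real.mul_self_sqrt ENNReal.toReal_nonneg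
  rw [← ofReal_norm]
  exact ENNReal.ofReal_le_of_le_toReal norm_le

theorem summable_of_tsum_eTrace {ι : Type*} {T : ι → H →L[ℂ] H} (hT : ∀ i, (T i).IsPositive)
    (h : ∑' i, eTrace (T i) ≠ ∞) : Summable T := by
  refine Summable.of_norm_bounded (ENNReal.summable_toReal h) fun i => ?_
  rw [← toReal_enorm]
  exact ENNReal.toReal_mono (ENNReal.ne_top_of_tsum_ne_top h i) (enorm_le_eTrace (hT i))

theorem summable_inner_basis {T : H →L[ℂ] H} (hT : T ∈ traceClass H) :
    Summable fun i => inner ℂ (basis H i) (T (basis H i)) := by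
  induction hT using Submodule.span_induction with
  | mem x h => exact h.2
  | zero => simp
  | add x y _ _ hx hy => simpa [inner_add_right] using hx.add hy
  | smul a x _ hx => simpa [inner_smul_right] using hx.mul_left a

theorem mem_traceClass_iff_eTrace_ne_top {T : H →L[ℂ] H} (hT : T.IsPositive) :
    T ∈ traceClass H ↔ eTrace T ≠ ∞ := by
  constructor <;> intro h
  · have hsum := summable_inner_basis h
    simp only [inner_eq_quadForm hT] at hsum
    have h_ofReal := ENNReal.ofReal_tsum_of_nonneg (fun i => ENNReal.toReal_nonneg)
      (Complex.summable_ofReal.1 hsum)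
    simp only [ENNReal.ofReal_toReal (quadForm_ne_top T _)] at h_ofReal
    rw [eTrace, ← h_ofReal]
    exact ENNReal.ofReal_ne_top
  · refine Submodule.subset_span ⟨hT, ?_⟩
    simp only [inner_eq_quadForm hT]
    exact Complex.summable_ofReal.2 (ENNReal.summable_toReal h)

theorem eTrace_ne_top {ρ : traceClass H} (hρ : ρ.1.IsPositive) : eTrace ρ.1 ≠ ∞ :=
  (mem_traceClass_iff_eTrace_ne_top hρ).1 ρ.2

theorem trace_eq_eTrace {ρ : traceClass H} (hρ : ρ.1.IsPositive) :
    trace ρ = ((eTrace ρ.1).toReal : ℂ) := by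
  rw [trace, eTrace, ENNReal.tsum_toReal_eq (fun i => quadForm_ne_top _ _), Complex.ofReal_tsum]
  exact tsum_congr fun i => inner_eq_quadForm hρ _

theorem trace_add (ρ σ : traceClass H) : trace (ρ + σ) = trace ρ + trace σ := by
  simp only [trace, Submodule.coe_add, add_apply, inner_add_right]
  exact (summable_inner_basis ρ.2).tsum_add (summable_inner_basis σ.2)

theorem trace_smul (c : ℂ) (ρ : traceClass H) : trace (c • ρ) = c * trace ρ := by
  simp only [trace, Submodule.coe_smul, smul_apply, inner_smul_right]
  exact tsum_mul_left

theorem traceClass_induction {p : traceClass H → Prop}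
    (pos : ∀ ρ : traceClass H, ρ.1.IsPositive → p ρ)
    (add : ∀ ρ σ, p ρ → p σ → p (ρ + σ)) (smul : ∀ (c : ℂ) ρ, p ρ → p (c • ρ))
    (ρ : traceClass H) : p ρ := by
  obtain ⟨T, hT⟩ := ρ
  induction hT using Submodule.span_induction with
  | mem x h => exact pos ⟨x, Submodule.subset_span h⟩ h.1
  | zero => exact pos 0 ContinuousLinearMap.isPositive_zero
  | add x y hx' hy' hx hy => exact add ⟨x, hx'⟩ ⟨y, hy'⟩ hx hy
  | smul a x hx' hx => exact smul a ⟨x, hx'⟩ hx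

theorem ketbra_isPositive (x : H) : (ketbra x).1.IsPositive :=
  InnerProductSpace.isPositive_rankOne_self x

theorem eTrace_ketbra (x : H) : eTrace (ketbra x).1 = ‖x‖ₑ ^ 2 := by
  rw [ketbra, (isDecomposition_rankOne x).eTrace_eq, tsum_fintype, Fintype.sum_unique]

theorem inner_ketbra (x y : H) :
    inner ℂ y ((ketbra x).1 y) = ((‖inner ℂ x y‖ₑ ^ 2).toReal : ℂ) := by
  rw [inner_eq_quadForm (ketbra_isPositive x), ketbra, ← isDecomposition_rankOne x y, tsum_fintype,
    Fintype.sum_unique]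

end Trace

section Operations

variable {ι H K L : Type*} [NormedAddCommGroup H] [InnerProductSpace ℂ H] [CompleteSpace H]
  [NormedAddCommGroup K] [InnerProductSpace ℂ K] [CompleteSpace K]
  [NormedAddCommGroup L] [InnerProductSpace ℂ L] [CompleteSpace L]

theorem IsCP.isPositive {E : Op H K} (h : IsCP E) {ρ : traceClass H} (hρ : ρ.1.IsPositive) :
    (E ρ).1.IsPositive :=
  isPositive_of_inner_nonneg fun x => by
    simpa using h 1 (fun _ _ => ρ) (fun ξ => by simpa using hρ.inner_nonneg_right (ξ 0)) fun _ => x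

theorem IsCP.comp {E : Op K L} {F : Op H K} (hE : IsCP E) (hF : IsCP F) : IsCP (E ∘ₗ F) :=
  fun n ρ h => hE n _ (hF n ρ h)

theorem isCP_zero : IsCP (0 : Op H K) := fun n ρ _ ξ => by simp

theorem isCP_of_hasSum {E : ι → Op H K} {F : Op H K} (hE : ∀ i, IsCP (E i))
    (h : ∀ ρ, HasSum (fun i => (E i ρ).1) (F ρ).1) : IsCP F := by
  intro n ρ hρ ξ
  have hsum : HasSum (fun k => ∑ i, ∑ j, inner ℂ (ξ i) ((E k (ρ i j)).1 (ξ j)))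
      (∑ i, ∑ j, inner ℂ (ξ i) ((F (ρ i j)).1 (ξ j))) :=
    hasSum_sum fun i _ => hasSum_sum fun j _ =>
      ((h (ρ i j)).mapL (ContinuousLinearMap.apply ℂ K (ξ j))).mapL (innerSL ℂ (ξ i))
  exact hsum.nonneg fun k => hE k n ρ hρ ξ

theorem hasSum_trace_iff {ρ : ι → traceClass H} {σ : traceClass K}
    (hρ : ∀ i, (ρ i).1.IsPositive) (hσ : σ.1.IsPositive) :
    HasSum (fun i => trace (ρ i)) (trace σ) ↔ ∑' i, eTrace (ρ i).1 = eTrace σ.1 := by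
  simp only [trace_eq_eTrace (hρ _), trace_eq_eTrace hσ, Complex.hasSum_ofReal]
  constructor <;> intro h
  · have h_ofReal := ENNReal.ofReal_tsum_of_nonneg (fun i => ENNReal.toReal_nonneg) h.summable
    rw [h.tsum_eq, ENNReal.ofReal_toReal (eTrace_ne_top hσ)] at h_ofReal
    simpa only [ENNReal.ofReal_toReal (eTrace_ne_top (hρ _))] using h_ofReal.symm
  · rw [← h, ENNReal.tsum_toReal_eq fun i => eTrace_ne_top (hρ i)]
    exact (ENNReal.summable_toReal (h ▸ eTrace_ne_top hσ)).hasSum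

theorem isInstrument_iff_tsum_eTrace {I : ι → Op H K} :
    IsInstrument I ↔ (∀ i, IsCP (I i)) ∧
      ∀ ρ : traceClass H, ρ.1.IsPositive → ∑' i, eTrace (I i ρ).1 = eTrace ρ.1 := by
  refine and_congr_right fun hI => ⟨fun h ρ hρ => ?_, fun h ρ => ?_⟩
  · exact (hasSum_trace_iff (fun i => (hI i).isPositive hρ) hρ).1 (h ρ)
  · induction ρ using traceClass_induction with
    | pos ρ hρ => exact (hasSum_trace_iff (fun i => (hI i).isPositive hρ) hρ).2 (h ρ hρ)
    | add ρ σ hρ hσ => simpa only [map_add, trace_add] using hρ.add hσ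
    | smul c ρ hρ => simpa only [map_smul, trace_smul] using hρ.mul_left c

theorem isInstrument_unit_iff {E : Op H K} : IsInstrument (fun _ : Unit => E) ↔ IsTPCP E := by
  refine and_congr (forall_const _) (forall_congr' fun ρ => ?_)
  exact ⟨fun h => (hasSum_unique _).unique h, fun h => h ▸ hasSum_unique _⟩

theorem IsInstrument.tsum_eTrace {I : ι → Op H K} (h : IsInstrument I) {ρ : traceClass H}
    (hρ : ρ.1.IsPositive) : ∑' i, eTrace (I i ρ).1 = eTrace ρ.1 :=
  (isInstrument_iff_tsum_eTrace.1 h).2 ρ hρ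

theorem isTPCP_iff_eTrace {E : Op H K} :
    IsTPCP E ↔
      IsCP E ∧ ∀ ρ : traceClass H, ρ.1.IsPositive → eTrace (E ρ).1 = eTrace ρ.1 := by
  simp only [← isInstrument_unit_iff, isInstrument_iff_tsum_eTrace, forall_const, tsum_fintype,
    Fintype.sum_unique]

theorem IsTPCP.comp {E : Op K L} {F : Op H K} (hE : IsTPCP E) (hF : IsTPCP F) :
    IsTPCP (E ∘ₗ F) :=
  ⟨hE.1.comp hF.1, fun ρ => (hE.2 _).trans (hF.2 ρ)⟩

theorem IsInstrument.postcomp {I : ι → Op H K} (hI : IsInstrument I) {P : ι → Op K L}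
    (hP : ∀ i, IsTPCP (P i)) : IsInstrument fun i => P i ∘ₗ I i :=
  ⟨fun i => (hP i).1.comp (hI.1 i), fun ρ => by
    simpa only [LinearMap.comp_apply, (hP _).2] using hI.2 ρ⟩

theorem IsInstrument.precomp {I : ι → Op K L} (hI : IsInstrument I) {E : Op H K}
    (hE : IsTPCP E) : IsInstrument fun i => I i ∘ₗ E :=
  ⟨fun i => (hI.1 i).comp hE.1, fun ρ => hE.2 ρ ▸ hI.2 (E ρ)⟩

/-- `E` maps positive operators to positive operators and increases their trace at most by the
factor `c`. -/
def IsBoundedPositive (E : Op H K) (c : ℝ≥0) : Prop :=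
  ∀ ρ : traceClass H, ρ.1.IsPositive → (E ρ).1.IsPositive ∧ eTrace (E ρ).1 ≤ c * eTrace ρ.1

theorem IsInstrument.isBoundedPositive {I : ι → Op H K} (h : IsInstrument I) (i : ι) :
    IsBoundedPositive (I i) 1 := fun ρ hρ =>
  ⟨(h.1 i).isPositive hρ, by
    rw [ENNReal.coe_one, one_mul, ← h.tsum_eTrace hρ]
    exact ENNReal.le_tsum i⟩

theorem IsBoundedPositive.comp {E : Op K L} {F : Op H K} {c d : ℝ≥0}
    (hE : IsBoundedPositive E c) (hF : IsBoundedPositive F d) :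
    IsBoundedPositive (E ∘ₗ F) (c * d) := fun ρ hρ => by
  obtain ⟨F_pos, F_le⟩ := hF ρ hρ
  obtain ⟨E_pos, E_le⟩ := hE _ F_pos
  refine ⟨E_pos, E_le.trans ?_⟩
  rw [ENNReal.coe_mul, mul_assoc]
  gcongr

theorem IsBoundedPositive.norm_trace_ketbra_le {E : Op H K} {c : ℝ≥0}
    (hE : IsBoundedPositive E c) (x : H) : ‖trace (E (ketbra x))‖ ≤ c * ‖x‖ ^ 2 := by
  obtain ⟨E_pos, E_le⟩ := hE _ (ketbra_isPositive x)
  rw [trace_eq_eTrace E_pos, Complex.norm_real, Real.norm_of_nonneg ENNReal.toReal_nonneg]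
  rw [eTrace_ketbra] at E_le
  simpa using
    ENNReal.toReal_mono (ENNReal.mul_ne_top ENNReal.coe_ne_top (enorm_sq_ne_top x)) E_le

theorem IsDecomposition.inner_sub_sum {T : H →L[ℂ] H} (hT : T.IsPositive) {ψ : ι → H}
    (hψ : IsDecomposition T ψ) (s : Finset ι) (x : H) :
    inner ℂ x ((T - ∑ i ∈ s, (ketbra (ψ i)).1) x) =
      ((∑' i : {i // i ∉ s}, ‖inner ℂ (ψ i) x‖ₑ ^ 2).toReal : ℂ) := by
  have split : ∑ i ∈ s, ‖inner ℂ (ψ i) x‖ₑ ^ 2 + ∑' i : {i // i ∉ s}, ‖inner ℂ (ψ i) x‖ₑ ^ 2 =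
      quadForm T x :=
    (ENNReal.sum_add_tsum_compl s fun i => ‖inner ℂ (ψ i) x‖ₑ ^ 2).trans (hψ x)
  have head_ne_top : ∀ i ∈ s, ‖inner ℂ (ψ i) x‖ₑ ^ 2 ≠ ∞ := fun i _ => enorm_sq_ne_top _
  have tail_ne_top : ∑' i : {i // i ∉ s}, ‖inner ℂ (ψ i) x‖ₑ ^ 2 ≠ ∞ :=
    ne_top_of_le_ne_top (split ▸ quadForm_ne_top T x) le_add_self
  rw [sub_apply, sum_apply, inner_sub_right, inner_sum, inner_eq_quadForm hT, ← split,
    ENNReal.toReal_add (ENNReal.sum_ne_top.2 head_ne_top) tail_ne_top,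
    ENNReal.toReal_sum head_ne_top]
  simp only [inner_ketbra, Complex.ofReal_add, Complex.ofReal_sum]
  ring

theorem IsDecomposition.isPositive_sub_sum {T : H →L[ℂ] H} (hT : T.IsPositive) {ψ : ι → H}
    (hψ : IsDecomposition T ψ) (s : Finset ι) : (T - ∑ i ∈ s, (ketbra (ψ i)).1).IsPositive :=
  isPositive_of_inner_nonneg fun x => by
    rw [hψ.inner_sub_sum hT s x, Complex.zero_le_real]
    exact ENNReal.toReal_nonneg

theorem IsDecomposition.sub_sum {T : H →L[ℂ] H} (hT : T.IsPositive) {ψ : ι → H}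
    (hψ : IsDecomposition T ψ) (s : Finset ι) :
    IsDecomposition (T - ∑ i ∈ s, (ketbra (ψ i)).1) fun i : {i // i ∉ s} => ψ i := fun x => by
  rw [quadForm, hψ.inner_sub_sum hT s x, Complex.ofReal_re, ENNReal.ofReal_toReal]
  refine ne_top_of_le_ne_top (quadForm_ne_top T x) ?_
  rw [← hψ x]
  exact ENNReal.tsum_comp_le_tsum_of_injective Subtype.val_injective
    fun i => ‖inner ℂ (ψ i) x‖ₑ ^ 2

theorem IsBoundedPositive.hasSum_ketbra {E : Op H K} {c : ℝ≥0} (hE : IsBoundedPositive E c)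
    {ρ : traceClass H} (hρ : ρ.1.IsPositive) {ψ : ι → H} (hψ : IsDecomposition ρ.1 ψ) :
    HasSum (fun i => (E (ketbra (ψ i))).1) (E ρ).1 := by
  have edist_le : ∀ s : Finset ι,
      edist (∑ i ∈ s, (E (ketbra (ψ i))).1) (E ρ).1 ≤ c * ∑' i : {i // i ∉ s}, ‖ψ i‖ₑ ^ 2 := by
    intro s
    obtain ⟨E_pos, E_le⟩ := hE (ρ - ∑ i ∈ s, ketbra (ψ i))
      (by simpa using hψ.isPositive_sub_sum hρ s)
    calc edist (∑ i ∈ s, (E (ketbra (ψ i))).1) (E ρ).1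
        = ‖(E (ρ - ∑ i ∈ s, ketbra (ψ i))).1‖ₑ := by
          rw [edist_comm, edist_eq_enorm_sub]
          simp
      _ ≤ c * eTrace (ρ - ∑ i ∈ s, ketbra (ψ i) : traceClass H).1 :=
          (enorm_le_eTrace E_pos).trans E_le
      _ = c * ∑' i : {i // i ∉ s}, ‖ψ i‖ₑ ^ 2 := by
          rw [← (hψ.sub_sum hρ s).eTrace_eq]
          simp
  have tail_tendsto := ENNReal.Tendsto.const_mul
    (ENNReal.tendsto_tsum_compl_atTop_zero (hψ.eTrace_eq ▸ eTrace_ne_top hρ))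
    (Or.inr (ENNReal.coe_ne_top (r := c)))
  rw [mul_zero] at tail_tendsto
  exact tendsto_iff_edist_tendsto_0.2 (tendsto_of_tendsto_of_tendsto_of_le_of_le
    tendsto_const_nhds tail_tendsto (fun _ => zero_le) edist_le)

theorem conj_mem_traceClass (S : H →L[ℂ] K) {T : H →L[ℂ] H} (hT : T ∈ traceClass H) :
    S ∘L T ∘L adjoint S ∈ traceClass K := by
  induction hT using Submodule.span_induction with
  | mem T hT =>
    refine (mem_traceClass_iff_eTrace_ne_top (hT.1.conj_adjoint S)).2 ?_
    have hT_top := (mem_traceClass_iff_eTrace_ne_top hT.1).1 (Submodule.subset_span hT)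
    exact ne_top_of_le_ne_top (ENNReal.mul_ne_top (enorm_sq_ne_top S) hT_top)
      (eTrace_conj_le hT.1 S)
  | zero => simp
  | add x y _ _ hx hy =>
    simpa only [ContinuousLinearMap.add_comp, ContinuousLinearMap.comp_add] using add_mem hx hy
  | smul a x _ hx =>
    simpa only [ContinuousLinearMap.smul_comp, ContinuousLinearMap.comp_smul] using
      Submodule.smul_mem _ a hx

/-- The conjugation `ρ ↦ S ρ S*` by a bounded operator `S`. -/
def conjOp (S : H →L[ℂ] K) : Op H K where
  toFun ρ := ⟨S ∘L ρ.1 ∘L adjoint S, conj_mem_traceClass S ρ.2⟩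
  map_add' ρ σ := by
    ext1
    simp [ContinuousLinearMap.add_comp, ContinuousLinearMap.comp_add]
  map_smul' c ρ := by
    ext1
    simp [ContinuousLinearMap.smul_comp]

theorem conjOp_apply (S : H →L[ℂ] K) (ρ : traceClass H) :
    (conjOp S ρ).1 = S ∘L ρ.1 ∘L adjoint S := rfl

theorem conjOp_ketbra (S : H →L[ℂ] K) (x : H) : conjOp S (ketbra x) = ketbra (S x) :=
  Subtype.ext (ketbra_map S x).symm

theorem conjOp_id : conjOp (ContinuousLinearMap.id ℂ H) = LinearMap.id := by
  ext ρ x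
  rw [conjOp_apply, ← ContinuousLinearMap.one_def, ContinuousLinearMap.adjoint_one]
  rfl

theorem isCP_conjOp (S : H →L[ℂ] K) : IsCP (conjOp S) := by
  intro n ρ h ξ
  refine (h fun i => adjoint S (ξ i)).trans_eq ?_
  simp [conjOp_apply, ContinuousLinearMap.adjoint_inner_left]

theorem eTrace_conjOp (S : H →L[ℂ] K) {ρ : traceClass H} {ψ : ι → H}
    (h : IsDecomposition ρ.1 ψ) : eTrace (conjOp S ρ).1 = ∑' i, ‖S (ψ i)‖ₑ ^ 2 :=
  (h.conj S).eTrace_eq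

theorem isBoundedPositive_conjOp (S : H →L[ℂ] K) : IsBoundedPositive (conjOp S) (‖S‖₊ ^ 2) :=
  fun _ hρ => ⟨(isCP_conjOp S).isPositive hρ, eTrace_conj_le hρ S⟩

theorem isTPCP_conjOp {S : H →L[ℂ] K} (hS : ∀ x, ‖S x‖ = ‖x‖) : IsTPCP (conjOp S) :=
  isTPCP_iff_eTrace.2 ⟨isCP_conjOp S, fun ρ hρ => by
    rw [eTrace_conjOp S (isDecomposition_sqrt hρ), (isDecomposition_sqrt hρ).eTrace_eq]
    simp only [enorm_sq_eq_ofReal, hS]⟩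

theorem exists_op_hasSum {E : ι → Op H K}
    (pos : ∀ i (ρ : traceClass H), ρ.1.IsPositive → (E i ρ).1.IsPositive)
    (tsum_ne_top : ∀ ρ : traceClass H, ρ.1.IsPositive → ∑' i, eTrace (E i ρ).1 ≠ ∞) :
    ∃ F : Op H K, ∀ ρ, HasSum (fun i => (E i ρ).1) (F ρ).1 := by
  have converges : ∀ ρ : traceClass H, Summable (fun i => (E i ρ).1) ∧
      ∑' i, (E i ρ).1 ∈ traceClass K := by
    intro ρ
    induction ρ using traceClass_induction with
    | pos ρ hρ =>
      have hsum := summable_of_tsum_eTrace (fun i => pos i ρ hρ) (tsum_ne_top ρ hρ)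
      refine ⟨hsum, (mem_traceClass_iff_eTrace_ne_top
        (isPositive_of_hasSum hsum.hasSum fun i => pos i ρ hρ)).2 ?_⟩
      rw [eTrace_eq_tsum hsum.hasSum fun i => pos i ρ hρ]
      exact tsum_ne_top ρ hρ
    | add ρ σ hρ hσ =>
      simp only [map_add, Submodule.coe_add]
      exact ⟨hρ.1.add hσ.1, hρ.1.tsum_add hσ.1 ▸ add_mem hρ.2 hσ.2⟩
    | smul c ρ hρ =>
      simp only [map_smul, Submodule.coe_smul]
      exact ⟨hρ.1.const_smul c, hρ.1.tsum_const_smul c ▸ Submodule.smul_mem _ c hρ.2⟩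
  let F : Op H K :=
    { toFun := fun ρ => ⟨∑' i, (E i ρ).1, (converges ρ).2⟩
      map_add' := fun ρ σ => by
        ext1
        simpa using (converges ρ).1.tsum_add (converges σ).1
      map_smul' := fun c ρ => by
        ext1
        simpa using (converges ρ).1.tsum_const_smul c }
  exact ⟨F, fun ρ => (converges ρ).1.hasSum⟩

theorem IsInstrument.exists_hasSum {I : ι → Op H K} (hI : IsInstrument I) :
    ∃ E : Op H K, IsTPCP E ∧ ∀ ρ, HasSum (fun i => (I i ρ).1) (E ρ).1 := by
  obtain ⟨E, hE⟩ := exists_op_hasSum (fun i ρ hρ => (hI.1 i).isPositive hρ)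
    fun ρ hρ => hI.tsum_eTrace hρ ▸ eTrace_ne_top hρ
  refine ⟨E, isTPCP_iff_eTrace.2 ⟨isCP_of_hasSum hI.1 hE, fun ρ hρ => ?_⟩, hE⟩
  rw [eTrace_eq_tsum (hE ρ) fun i => (hI.1 i).isPositive hρ, hI.tsum_eTrace hρ]

omit [CompleteSpace H] in
theorem IsDecomposition.exists_nat {T : H →L[ℂ] H} {ψ : ι → H} (h : IsDecomposition T ψ)
    (hψ : (Function.support ψ).Countable) : ∃ φ : ℕ → H, IsDecomposition T φ := by
  have : Countable (Function.support ψ) := hψ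
  obtain ⟨f, hf⟩ := exists_injective_nat (Function.support ψ)
  refine ⟨Function.extend f (fun i => ψ i) 0, fun x => ?_⟩
  have apply_extend : ∀ n, ‖inner ℂ (Function.extend f (fun i => ψ i) 0 n) x‖ₑ ^ 2 =
      Function.extend f (fun i => ‖inner ℂ (ψ i) x‖ₑ ^ 2) 0 n := fun n => by
    by_cases hn : ∃ i, f i = n
    · obtain ⟨i, rfl⟩ := hn
      simp only [hf.extend_apply]
    · simp [Function.extend_apply' _ _ _ hn]
  rw [tsum_congr apply_extend, tsum_extend_zero hf, ← h x]
  refine tsum_subtype_eq_of_support_subset (f := fun i => ‖inner ℂ (ψ i) x‖ₑ ^ 2) fun i hi => ?_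
  contrapose! hi
  simp [Function.notMem_support.1 hi]

theorem exists_nat_isDecomposition {ρ : traceClass H} (hρ : ρ.1.IsPositive) :
    ∃ ψ : ℕ → H, IsDecomposition ρ.1 ψ := by
  refine (isDecomposition_sqrt hρ).exists_nat ?_
  have tsum_ne_top : ∑' i, ‖CFC.sqrt ρ.1 (basis H i)‖ₑ ^ 2 ≠ ∞ :=
    (isDecomposition_sqrt hρ).eTrace_eq ▸ eTrace_ne_top hρ
  refine (Summable.countable_support_ennreal tsum_ne_top).mono fun i hi => ?_
  simpa using hi

end Operations

section Tensor

universe u v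

variable {A A' A'' : Type u} {B B' B'' : Type v}
variable [NormedAddCommGroup A] [InnerProductSpace ℂ A]
variable [NormedAddCommGroup B] [InnerProductSpace ℂ B]
variable [NormedAddCommGroup A'] [InnerProductSpace ℂ A']
variable [NormedAddCommGroup B'] [InnerProductSpace ℂ B']
variable [NormedAddCommGroup A''] [InnerProductSpace ℂ A'']
variable [NormedAddCommGroup B''] [InnerProductSpace ℂ B'']

theorem inner_tens (a a' : A) (b b' : B) :
    inner ℂ (tens a b) (tens a' b') = inner ℂ a a' * inner ℂ b b' := by
  rw [tens, tens, UniformSpace.Completion.inner_coe, TensorProduct.inner_tmul]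

theorem opTensor_tens (X : A →L[ℂ] A') (Y : B →L[ℂ] B') (a : A) (b : B) :
    opTensor X Y (tens a b) = tens (X a) (Y b) := by
  rw [opTensor, tens, ContinuousLinearMap.completion_apply_coe, TensorProduct.mapL_tmul, tens]

variable (A B) in
/-- The product vector `tens a b` as a bounded bilinear map. -/
def tensL : A →L[ℂ] B →L[ℂ] HTensor A B :=
  (ContinuousLinearMap.compL ℂ B (A ⊗[ℂ] B) (HTensor A B)
    UniformSpace.Completion.toComplL) ∘L TensorProduct.mkL ℂ A B

theorem tensL_apply (a : A) (b : B) : tensL A B a b = tens a b := rfl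

theorem clm_ext_tens {E : Type*} [NormedAddCommGroup E] [NormedSpace ℂ E]
    {S T : HTensor A B →L[ℂ] E} (h : ∀ a b, S (tens a b) = T (tens a b)) : S = T := by
  ext x
  induction x using UniformSpace.Completion.induction_on with
  | hp => exact isClosed_eq S.continuous T.continuous
  | ih x =>
    induction x using TensorProduct.induction_on with
    | zero => rw [UniformSpace.Completion.coe_zero, map_zero, map_zero]
    | tmul a b => exact h a b
    | add x y hx hy => rw [UniformSpace.Completion.coe_add, map_add, map_add, hx, hy]

theorem ext_inner_tens {x y : HTensor A B}
    (h : ∀ a b, inner ℂ (tens a b) x = inner ℂ (tens a b) y) : x = y := by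
  have hxy : innerSL ℂ x = innerSL ℂ y := clm_ext_tens fun a b => by
    rw [innerSL_apply_apply, innerSL_apply_apply, ← inner_conj_symm, h, inner_conj_symm]
  exact ext_inner_right ℂ fun z => DFunLike.congr_fun hxy z

theorem opTensor_opTensor (X : A →L[ℂ] A') (X' : A' →L[ℂ] A'') (Y : B →L[ℂ] B')
    (Y' : B' →L[ℂ] B'') (x : HTensor A B) :
    opTensor X' Y' (opTensor X Y x) = opTensor (X' ∘L X) (Y' ∘L Y) x := by
  suffices opTensor X' Y' ∘L opTensor X Y = opTensor (X' ∘L X) (Y' ∘L Y) from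
    DFunLike.congr_fun this x
  exact clm_ext_tens fun a b => by simp [opTensor_tens]

theorem opTensor_id : opTensor (.id ℂ A) (.id ℂ B) = .id ℂ (HTensor A B) :=
  clm_ext_tens fun a b => by simp [opTensor_tens]

theorem opTensor_zero_left (Y : B →L[ℂ] B') : opTensor (0 : A →L[ℂ] A') Y = 0 :=
  clm_ext_tens fun a b => by rw [opTensor_tens, ← tensL_apply]; simp

theorem opTensor_rankOne (a a' : A) (b b' : B) :
    opTensor (InnerProductSpace.rankOne ℂ a a') (InnerProductSpace.rankOne ℂ b b') =
      InnerProductSpace.rankOne ℂ (tens a b) (tens a' b') :=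
  clm_ext_tens fun x y => by
    rw [opTensor_tens, InnerProductSpace.rankOne_apply, InnerProductSpace.rankOne_apply,
      InnerProductSpace.rankOne_apply, inner_tens, ← tensL_apply, ← tensL_apply]
    simp [smul_smul, mul_comm]

/-- The exchange `a ⊗ b ↦ b ⊗ a` of the two tensor factors. -/
def swap : HTensor A B →L[ℂ] HTensor B A :=
  ((TensorProduct.commIsometry ℂ A B).toLinearIsometry.toContinuousLinearMap).completion

theorem swap_tens (a : A) (b : B) : swap (tens a b) = tens b a := by
  rw [swap, tens, ContinuousLinearMap.completion_apply_coe]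
  rfl

theorem swap_swap (x : HTensor A B) : swap (swap x) = x := by
  suffices swap ∘L swap = ContinuousLinearMap.id ℂ (HTensor A B) from DFunLike.congr_fun this x
  exact clm_ext_tens fun a b => by simp [swap_tens]

theorem swap_opTensor (X : A →L[ℂ] A') (Y : B →L[ℂ] B') (x : HTensor A B) :
    swap (opTensor X Y x) = opTensor Y X (swap x) := by
  suffices swap ∘L opTensor X Y = opTensor Y X ∘L swap from DFunLike.congr_fun this x
  exact clm_ext_tens fun a b => by simp [opTensor_tens, swap_tens]

theorem opTensor_swap (X : A →L[ℂ] A') (Y : B →L[ℂ] B') (x : HTensor B A) :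
    opTensor X Y (swap x) = swap (opTensor Y X x) :=
  (swap_opTensor Y X x).symm

variable [CompleteSpace A] [CompleteSpace B] [CompleteSpace A'] [CompleteSpace B']
  [CompleteSpace A''] [CompleteSpace B'']

theorem opTensor_ketbra (a : A) (b : B) :
    opTensor (ketbra a).1 (ketbra b).1 = (ketbra (tens a b)).1 := opTensor_rankOne a a b b

theorem adjoint_opTensor (X : A →L[ℂ] A') (Y : B →L[ℂ] B') :
    adjoint (opTensor X Y) = opTensor (adjoint X) (adjoint Y) :=
  clm_ext_tens fun a b => ext_inner_tens fun a' b' => by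
    simp [ContinuousLinearMap.adjoint_inner_right, opTensor_tens, inner_tens]

omit [CompleteSpace A] [CompleteSpace B] in
theorem adjoint_swap : adjoint (swap : HTensor A B →L[ℂ] HTensor B A) = swap :=
  clm_ext_tens fun b a => ext_inner_tens fun a' b' => by
    simp [ContinuousLinearMap.adjoint_inner_right, swap_tens, inner_tens, mul_comm]

omit [CompleteSpace A] [CompleteSpace B] in
theorem norm_swap (x : HTensor A B) : ‖swap x‖ = ‖x‖ := by
  refine (ContinuousLinearMap.norm_map_iff_adjoint_comp_self _).2 ?_ x
  ext x : 1
  rw [adjoint_swap]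
  exact swap_swap x

variable (A) in
/-- The partial inner product `⟪b, ·⟫ : A ⊗ B → A`, as an antilinear function of `b`. -/
def slice : B →L⋆[ℂ] HTensor A B →L[ℂ] A :=
  (adjoint (𝕜 := ℂ) (E := A) (F := HTensor A B)).toLinearIsometry.toContinuousLinearMap.comp
    (tensL A B).flip

omit [CompleteSpace B] in
theorem adjoint_slice (a : A) (b : B) : adjoint (slice A b) a = tens a b :=
  congrArg (· a) (ContinuousLinearMap.adjoint_adjoint ((tensL A B).flip b))

omit [CompleteSpace B] in
theorem inner_slice (a : A) (b : B) (x : HTensor A B) :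
    inner ℂ a (slice A b x) = inner ℂ (tens a b) x := by
  rw [← adjoint_slice, ContinuousLinearMap.adjoint_inner_left]

omit [CompleteSpace B] in
theorem slice_tens (a : A) (b b' : B) : slice A b (tens a b') = inner ℂ b b' • a :=
  ext_inner_left ℂ fun x => by rw [inner_slice, inner_tens, inner_smul_right, mul_comm]

theorem slice_opTensor (X : A →L[ℂ] A') (Y : B →L[ℂ] B') (b : B') (x : HTensor A B) :
    slice A' b (opTensor X Y x) = X (slice A (adjoint Y b) x) :=
  ext_inner_left ℂ fun a => by
    rw [inner_slice, ← ContinuousLinearMap.adjoint_inner_left, adjoint_opTensor, opTensor_tens,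
      ← ContinuousLinearMap.adjoint_inner_left X, inner_slice]

omit [CompleteSpace B] in
theorem ext_slice {x y : HTensor A B} (h : ∀ b : B, slice A b x = slice A b y) : x = y :=
  ext_inner_tens fun a b => by rw [← inner_slice, h, inner_slice]

theorem inner_slice_swap (a : A) (b : B) (x : HTensor A B) :
    inner ℂ b (slice B a (swap x)) = inner ℂ a (slice A b x) := by
  rw [inner_slice, inner_slice, ← ContinuousLinearMap.adjoint_inner_left, adjoint_swap, swap_tens]

/-- The Hilbert basis `e i ⊗ f j` of the tensor product. -/
def prodBasis {ι κ : Type*} (e : HilbertBasis ι ℂ A) (f : HilbertBasis κ ℂ B) :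
    HilbertBasis (ι × κ) ℂ (HTensor A B) :=
  HilbertBasis.mkOfOrthogonalEqBot (v := fun i => tens (e i.1) (f i.2))
    (by
      classical
      have h := Orthonormal.tmul e.orthonormal f.orthonormal
      rw [orthonormal_iff_ite] at h ⊢
      intro i j
      rw [← h i j, tens, tens, UniformSpace.Completion.inner_coe])
    (by
      refine (Submodule.eq_bot_iff _).2 fun x hx => ?_
      have inner_eq_zero : ∀ i j, inner ℂ (tens (e i) (f j)) x = 0 := fun i j =>
        (Submodule.mem_orthogonal _ _).1 hx _ (Submodule.subset_span ⟨(i, j), rfl⟩)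
      have slice_eq_zero : ∀ j, slice A (f j) x = 0 := fun j =>
        e.repr.map_eq_zero_iff.1 <| lp.ext <| funext fun i => by
          simp [HilbertBasis.repr_apply_apply, inner_slice, inner_eq_zero]
      have swap_eq_zero : swap x = 0 := ext_slice fun a => by
        refine f.repr.map_eq_zero_iff.1 (lp.ext <| funext fun j => ?_) |>.trans (map_zero _).symm
        simp [HilbertBasis.repr_apply_apply, inner_slice_swap, slice_eq_zero]
      rw [← swap_swap x, swap_eq_zero, map_zero])

theorem prodBasis_apply {ι κ : Type*} (e : HilbertBasis ι ℂ A) (f : HilbertBasis κ ℂ B)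
    (i : ι × κ) : prodBasis e f i = tens (e i.1) (f i.2) := by
  rw [prodBasis, HilbertBasis.coe_mkOfOrthogonalEqBot]

theorem tsum_enorm_slice_sq (x : HTensor A B) :
    ∑' j, ‖slice A (basis B j) x‖ₑ ^ 2 = ‖x‖ₑ ^ 2 := by
  rw [← tsum_enorm_inner_sq (prodBasis (basis A) (basis B)), ENNReal.tsum_prod', ENNReal.tsum_comm]
  simp only [prodBasis_apply, ← inner_slice, tsum_enorm_inner_sq]

theorem slice_opTensor_id (X : A →L[ℂ] A') (b : B) (x : HTensor A B) :
    slice A' b (opTensor X (.id ℂ B) x) = X (slice A b x) := by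
  rw [slice_opTensor, ← ContinuousLinearMap.one_def, ContinuousLinearMap.adjoint_one]
  rfl

theorem tsum_enorm_opTensor_id_sq_le {ι : Type*} {Y : ι → A →L[ℂ] A''} {X : A →L[ℂ] A'}
    (h : ∀ a, ∑' i, ‖Y i a‖ₑ ^ 2 ≤ ‖X a‖ₑ ^ 2) (x : HTensor A B) :
    ∑' i, ‖opTensor (Y i) (.id ℂ B) x‖ₑ ^ 2 ≤ ‖opTensor X (.id ℂ B) x‖ₑ ^ 2 := by
  simp only [← tsum_enorm_slice_sq (opTensor _ _ x), slice_opTensor_id]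
  rw [ENNReal.tsum_comm]
  exact ENNReal.tsum_le_tsum fun j => h _

theorem tsum_enorm_opTensor_id_sq_eq {ι : Type*} {Y : ι → A →L[ℂ] A''} {X : A →L[ℂ] A'}
    (h : ∀ a, ∑' i, ‖Y i a‖ₑ ^ 2 = ‖X a‖ₑ ^ 2) (x : HTensor A B) :
    ∑' i, ‖opTensor (Y i) (.id ℂ B) x‖ₑ ^ 2 = ‖opTensor X (.id ℂ B) x‖ₑ ^ 2 := by
  simp only [← tsum_enorm_slice_sq (opTensor _ _ x), slice_opTensor_id]
  rw [ENNReal.tsum_comm]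
  exact tsum_congr fun j => h _

end Tensor

section NoSignalling

section Effect

variable {H K : Type*} [NormedAddCommGroup H] [InnerProductSpace ℂ H] [CompleteSpace H]
  [NormedAddCommGroup K] [InnerProductSpace ℂ K] [CompleteSpace K]

omit [CompleteSpace H] in
theorem four_smul_rankOne (x y : H) :
    (4 : ℂ) • InnerProductSpace.rankOne ℂ x y =
      InnerProductSpace.rankOne ℂ (x + y) (x + y) - InnerProductSpace.rankOne ℂ (x - y) (x - y) +
        Complex.I • InnerProductSpace.rankOne ℂ (x + Complex.I • y) (x + Complex.I • y) -
        Complex.I • InnerProductSpace.rankOne ℂ (x - Complex.I • y) (x - Complex.I • y) := by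
  ext z
  simp only [InnerProductSpace.rankOne_apply, smul_apply, sub_apply, add_apply, inner_add_left,
    inner_sub_left, inner_smul_left, Complex.conj_I]
  match_scalars <;> (ring_nf; simp only [Complex.I_sq]; ring)

theorem rankOne_mem_traceClass (x y : H) : InnerProductSpace.rankOne ℂ x y ∈ traceClass H := by
  rw [← Submodule.smul_mem_iff _ (four_ne_zero' ℂ), four_smul_rankOne]
  exact sub_mem (add_mem (sub_mem (ketbra _).2 (ketbra _).2) (Submodule.smul_mem _ _ (ketbra _).2))
    (Submodule.smul_mem _ _ (ketbra _).2)

variable (H) in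
/-- The rank one operator `|y⟩⟨x|` as a sesquilinear function of `x` and `y`. -/
def crossKet : H →ₗ⋆[ℂ] H →ₗ[ℂ] traceClass H :=
  LinearMap.mk₂'ₛₗ _ _ (fun x y => ⟨InnerProductSpace.rankOne ℂ y x, rankOne_mem_traceClass y x⟩)
    (fun _ _ _ => Subtype.ext (by simp)) (fun _ _ _ => Subtype.ext (by simp))
    (fun _ _ _ => Subtype.ext (by simp)) (fun _ _ _ => Subtype.ext (by simp))

theorem crossKet_self (x : H) : crossKet H x x = ketbra x := rfl

theorem four_smul_crossKet (x y : H) :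
    (4 : ℂ) • crossKet H y x = ketbra (x + y) - ketbra (x - y) +
      Complex.I • ketbra (x + Complex.I • y) - Complex.I • ketbra (x - Complex.I • y) :=
  Subtype.ext (four_smul_rankOne x y)

theorem ketbra_smul (c : ℂ) (x : H) : ketbra (c • x) = (starRingEnd ℂ c * c) • ketbra x := by
  rw [← crossKet_self, (crossKet H).map_smulₛₗ, map_smul, LinearMap.smul_apply, smul_smul,
    mul_comm, crossKet_self]

variable {τ : traceClass H →ₗ[ℂ] ℂ} {c : ℝ}

theorem norm_crossKet_le_add_sq (hτ : ∀ x, ‖τ (ketbra x)‖ ≤ c * ‖x‖ ^ 2) (x y : H) :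
    ‖τ (crossKet H x y)‖ ≤ c * (‖x‖ ^ 2 + ‖y‖ ^ 2) := by
  have polarization := congrArg (‖τ ·‖) (four_smul_crossKet y x)
  simp only [map_smul, map_sub, map_add, norm_smul, Complex.norm_ofNat] at polarization
  have sum_le : 4 * ‖τ (crossKet H x y)‖ ≤
      c * ‖y + x‖ ^ 2 + c * ‖y - x‖ ^ 2 + c * ‖y + Complex.I • x‖ ^ 2 +
        c * ‖y - Complex.I • x‖ ^ 2 := by
    rw [polarization]
    refine (norm_sub_le _ _).trans (add_le_add ((norm_add_le _ _).trans
      (add_le_add ((norm_sub_le _ _).trans (add_le_add (hτ _) (hτ _))) ?_)) ?_) <;>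
    simpa [norm_smul] using hτ _
  have parallelogram := parallelogram_law_with_norm ℂ y x
  have parallelogram_I := parallelogram_law_with_norm ℂ y (Complex.I • x)
  rw [norm_smul, Complex.norm_I, one_mul] at parallelogram_I
  linear_combination (sum_le + c * parallelogram + c * parallelogram_I) / 4

theorem norm_crossKet_le (hτ : ∀ x, ‖τ (ketbra x)‖ ≤ c * ‖x‖ ^ 2) (x y : H) :
    ‖τ (crossKet H x y)‖ ≤ 2 * c * ‖x‖ * ‖y‖ := by
  obtain rfl | hx := eq_or_ne x 0
  · simp
  obtain rfl | hy := eq_or_ne y 0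
  · simp
  have norm_unit : ∀ {z : H}, z ≠ 0 → ‖((‖z‖⁻¹ : ℝ) : ℂ) • z‖ = 1 := fun hz => by
    simpa using norm_smul_inv_norm (𝕜 := ℂ) hz
  have unit_le := norm_crossKet_le_add_sq hτ (((‖x‖⁻¹ : ℝ) : ℂ) • x) (((‖y‖⁻¹ : ℝ) : ℂ) • y)
  rw [norm_unit hx, norm_unit hy, (crossKet H).map_smulₛₗ, map_smul, LinearMap.smul_apply,
    map_smul, map_smul, norm_smul, norm_smul, RCLike.norm_conj, Complex.norm_real,
    Complex.norm_real, norm_inv, norm_inv, norm_norm, norm_norm,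
    inv_mul_le_iff₀ (norm_pos_iff.2 hy), inv_mul_le_iff₀ (norm_pos_iff.2 hx)] at unit_le
  linear_combination unit_le

theorem exists_inner_eq (hτ : ∀ x, ‖τ (ketbra x)‖ ≤ c * ‖x‖ ^ 2) :
    ∃ M : H →L[ℂ] H, ∀ x, inner ℂ (M x) x = τ (ketbra x) :=
  let form : H →L⋆[ℂ] H →L[ℂ] ℂ :=
    ((crossKet H).compr₂ₛₗ τ).mkContinuous₂ (2 * c) (norm_crossKet_le hτ)
  ⟨InnerProductSpace.continuousLinearMapOfBilin form, fun x =>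
    InnerProductSpace.continuousLinearMapOfBilin_apply form x x⟩

theorem IsBoundedPositive.exists_effect {E : Op H K} {c : ℝ≥0} (hE : IsBoundedPositive E c) :
    ∃ M : H →L[ℂ] H, ∀ x, inner ℂ (M x) x = trace (E (ketbra x)) :=
  exists_inner_eq (τ := IsLinearMap.mk' trace ⟨trace_add, trace_smul⟩ ∘ₗ E)
    hE.norm_trace_ketbra_le

end Effect

universe u v

variable {A A₁ : Type u} {B : Type v}
variable [NormedAddCommGroup A] [InnerProductSpace ℂ A] [CompleteSpace A]
variable [NormedAddCommGroup A₁] [InnerProductSpace ℂ A₁] [CompleteSpace A₁]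
variable [NormedAddCommGroup B] [InnerProductSpace ℂ B] [CompleteSpace B]

theorem eq_zero_of_inner_tens {M : HTensor A B →L[ℂ] HTensor A B}
    (h : ∀ a b, inner ℂ (M (tens a b)) (tens a b) = 0) : M = 0 := by
  have slice_eq_zero : ∀ a b, slice A b (M (tens a b)) = 0 := fun a b => by
    have := (inner_map_self_eq_zero
      (slice A b ∘L M ∘L (tensL A B).flip b : A →L[ℂ] A).toLinearMap).1 fun a => by
        rw [← inner_conj_symm]
        exact (congrArg _ ((inner_slice a b _).trans (inner_eq_zero_symm.1 (h a b)))).trans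
          (map_zero _)
    exact DFunLike.congr_fun this a
  have slice_swap_eq_zero : ∀ a a' b, slice B a' (swap (M (tens a b))) = 0 := fun a a' b => by
    have := (inner_map_self_eq_zero
      (slice B a' ∘L swap ∘L M ∘L tensL A B a : B →L[ℂ] B).toLinearMap).1 fun b => by
        rw [← inner_conj_symm]
        refine (congrArg _ ((inner_slice_swap a' b _).trans ?_)).trans (map_zero _)
        exact (congrArg _ (slice_eq_zero a b)).trans (inner_zero_right _)
    exact DFunLike.congr_fun this b
  refine clm_ext_tens fun a b => ext_inner_tens fun a' b' => ?_
  rw [← inner_slice, ← inner_slice_swap, slice_swap_eq_zero, inner_zero_right, zero_apply,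
    inner_zero_right]

theorem trace_ketbra_eq_of_tens {H K : Type*} [NormedAddCommGroup H] [InnerProductSpace ℂ H]
    [CompleteSpace H] [NormedAddCommGroup K] [InnerProductSpace ℂ K] [CompleteSpace K]
    {E : Op (HTensor A B) H} {G : Op (HTensor A B) K} {c d : ℝ≥0} (hE : IsBoundedPositive E c)
    (hG : IsBoundedPositive G d)
    (h : ∀ a b, trace (E (ketbra (tens a b))) = trace (G (ketbra (tens a b))))
    (x : HTensor A B) : trace (E (ketbra x)) = trace (G (ketbra x)) := by
  obtain ⟨M, hM⟩ := hE.exists_effect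
  obtain ⟨N, hN⟩ := hG.exists_effect
  have M_eq_N : M = N := sub_eq_zero.1 <| eq_zero_of_inner_tens fun a b => by
    rw [sub_apply, inner_sub_left, hM, hN, h, sub_self]
  rw [← hM, ← hN, M_eq_N]

theorem eTrace_eq_of_trace_eq {H K : Type*} [NormedAddCommGroup H] [InnerProductSpace ℂ H]
    [CompleteSpace H] [NormedAddCommGroup K] [InnerProductSpace ℂ K] [CompleteSpace K]
    {ρ : traceClass H} {σ : traceClass K} (hρ : ρ.1.IsPositive) (hσ : σ.1.IsPositive)
    (h : trace ρ = trace σ) : eTrace ρ.1 = eTrace σ.1 := by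
  rw [trace_eq_eTrace hρ, trace_eq_eTrace hσ] at h
  exact (ENNReal.toReal_eq_toReal_iff' (eTrace_ne_top hρ) (eTrace_ne_top hσ)).1
    (Complex.ofReal_injective h)

/-- On product vectors both sides are `|⟪b, b'⟫|² tr J(|a⟩⟨a|)`, and this suffices. -/
theorem IsTensorOp.eTrace_conj_slice {F : Op (HTensor A B) (HTensor A₁ B)} {J : Op A A₁} {c d : ℝ≥0}
    (h : IsTensorOp F J LinearMap.id) (hF : IsBoundedPositive F c) (hJ : IsBoundedPositive J d)
    (b : B) (x : HTensor A B) :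
    eTrace (conjOp (slice A₁ b) (F (ketbra x))).1 = eTrace (J (ketbra (slice A b x))).1 := by
  have hl := (isBoundedPositive_conjOp (slice A₁ b)).comp hF
  have hr := hJ.comp (isBoundedPositive_conjOp (slice A b))
  rw [← conjOp_ketbra]
  refine eTrace_eq_of_trace_eq (hl _ (ketbra_isPositive x)).1 (hr _ (ketbra_isPositive x)).1
    (trace_ketbra_eq_of_tens hl hr (fun a b' => congrArg trace (Subtype.ext ?_)) x)
  ext y
  have ketbra_apply : (ketbra b').1 b = inner ℂ b' b • b' := rfl
  rw [LinearMap.comp_apply, LinearMap.comp_apply, conjOp_ketbra, slice_tens, ketbra_smul, map_smul,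
    conjOp_apply, h.2, ContinuousLinearMap.comp_apply, ContinuousLinearMap.comp_apply,
    adjoint_slice, opTensor_tens, LinearMap.id_apply, ketbra_apply, slice_tens, inner_smul_right,
    inner_conj_symm]
  rfl

/-- No signalling from Alice to Bob. -/
theorem IsLocalAlice.tsum_enorm_slice_sq {F : ℕ → Op (HTensor A B) (HTensor A₁ B)}
    (hF : IsLocalAlice F) (x : HTensor A B) {ι : ℕ → Type*} {ψ : ∀ k, ι k → HTensor A₁ B}
    (hψ : ∀ k, IsDecomposition (F k (ketbra x)).1 (ψ k)) (b : B) :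
    ∑' k, ∑' j, ‖slice A₁ b (ψ k j)‖ₑ ^ 2 = ‖slice A b x‖ₑ ^ 2 := by
  obtain ⟨F_inst, J, J_inst, F_eq⟩ := hF
  rw [← eTrace_ketbra, ← J_inst.tsum_eTrace (ketbra_isPositive _)]
  refine tsum_congr fun k => ?_
  rw [← (F_eq k).eTrace_conj_slice (F_inst.isBoundedPositive k) (J_inst.isBoundedPositive k),
    eTrace_conjOp _ (hψ k)]

end NoSignalling

section Factorization

section Column

variable {ι E K : Type*} [AddCommGroup E] [Module ℂ E] [NormedAddCommGroup K]

theorem enorm_lp_sq (x : lp (fun _ : ι => K) 2) : ‖x‖ₑ ^ 2 = ∑' i, ‖x i‖ₑ ^ 2 := by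
  have norm_sq : ‖x‖ ^ 2 = ∑' i, ‖x i‖ ^ 2 := by
    simpa using! lp.norm_rpow_eq_tsum (p := 2) (by norm_num) x
  have summable_sq : Summable fun i => ‖x i‖ ^ 2 := by
    simpa using (lp.memℓp x).summable (by norm_num)
  rw [enorm_sq_eq_ofReal, norm_sq, ENNReal.ofReal_tsum_of_nonneg (fun i => by positivity)
    summable_sq]
  simp only [enorm_sq_eq_ofReal]

/-- The column operator `x ↦ (Y i x)ᵢ` into the Hilbert sum. -/
def column [NormedSpace ℂ K] (Y : ι → E →ₗ[ℂ] K) (h : ∀ x, ∑' i, ‖Y i x‖ₑ ^ 2 ≠ ∞) :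
    E →ₗ[ℂ] lp (fun _ : ι => K) 2 where
  toFun x := ⟨fun i => Y i x, by
    refine (memℓp_gen_iff (by norm_num)).2 ?_
    simpa using ENNReal.summable_toReal (h x)⟩
  map_add' x y := by ext i; exact map_add (Y i) x y
  map_smul' c x := by ext i; exact map_smul (Y i) c x

theorem enorm_column_sq [NormedSpace ℂ K] {Y : ι → E →ₗ[ℂ] K}
    (h : ∀ x, ∑' i, ‖Y i x‖ₑ ^ 2 ≠ ∞) (x : E) : ‖column Y h x‖ₑ ^ 2 = ∑' i, ‖Y i x‖ₑ ^ 2 :=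
  enorm_lp_sq _

end Column

variable {ι H K L : Type*} [NormedAddCommGroup H] [InnerProductSpace ℂ H] [CompleteSpace H]
  [NormedAddCommGroup K] [InnerProductSpace ℂ K] [CompleteSpace K]
  [NormedAddCommGroup L] [InnerProductSpace ℂ L] [CompleteSpace L]

/-- Douglas' lemma. -/
theorem exists_contraction_comp_eq {E : Type*} [AddCommGroup E] [Module ℂ E] {R : E →ₗ[ℂ] H}
    {T : E →ₗ[ℂ] K} (h : ∀ e, ‖T e‖ ≤ ‖R e‖) :
    ∃ C : H →L[ℂ] K, ‖C‖ ≤ 1 ∧ ∀ e, C (R e) = T e := by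
  let M : Submodule ℂ H := (LinearMap.range R).topologicalClosure
  have : CompleteSpace M := (Submodule.isClosed_topologicalClosure _).completeSpace_coe
  let R' : E →ₗ[ℂ] M := R.codRestrict M fun e =>
    Submodule.le_topologicalClosure _ (LinearMap.mem_range_self R e)
  have denseRange : DenseRange R' := by
    intro x
    have image_eq : Subtype.val '' Set.range R' = (LinearMap.range R : Set H) :=
      (Set.range_comp _ _).symm
    rw [closure_subtype, image_eq]
    exact x.2
  have norm_le : ∀ e, ‖T e‖ ≤ 1 * ‖R' e‖ := fun e => by simpa [R'] using h e
  refine ⟨T.extendOfNorm R' ∘L M.orthogonalProjectionOnto,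
    ContinuousLinearMap.opNorm_le_bound _ zero_le_one fun x => ?_, fun e => ?_⟩
  · refine (LinearMap.norm_extendOfNorm_apply_le denseRange 1 norm_le _).trans ?_
    gcongr
    exact M.norm_orthogonalProjectionOnto_apply_le x
  · have projection_eq : M.orthogonalProjectionOnto (R e) = R' e :=
      M.orthogonalProjectionOnto_mem_subspace_eq_self (R' e)
    rw [ContinuousLinearMap.comp_apply, projection_eq,
      LinearMap.extendOfNorm_eq denseRange ⟨1, norm_le⟩]

/-- Kraus operators of a trace nonincreasing operation: `∑ i, (K i)* K i ≤ 1`. -/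
def IsSubKraus (Y : ι → H →L[ℂ] K) : Prop := ∀ x, ∑' i, ‖Y i x‖ₑ ^ 2 ≤ ‖x‖ₑ ^ 2

theorem exists_isSubKraus_comp_eq {E : Type*} [AddCommGroup E] [Module ℂ E] {R : E →ₗ[ℂ] H}
    {T : ι → E →ₗ[ℂ] K} (h : ∀ e, ∑' i, ‖T i e‖ₑ ^ 2 ≤ ‖R e‖ₑ ^ 2) :
    ∃ C : ι → H →L[ℂ] K, IsSubKraus C ∧ ∀ i e, C i (R e) = T i e := by
  have ne_top : ∀ e, ∑' i, ‖T i e‖ₑ ^ 2 ≠ ∞ := fun e =>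
    ne_top_of_le_ne_top (enorm_sq_ne_top _) (h e)
  obtain ⟨C, C_le, C_eq⟩ := exists_contraction_comp_eq (R := R) (T := column T ne_top) fun e =>
    enorm_sq_le_enorm_sq_iff.1 ((enorm_column_sq ne_top e).trans_le (h e))
  refine ⟨fun i => lp.evalCLM ℂ (fun _ : ι => K) 2 i ∘L C, fun x => ?_,
    fun i e => congrArg (fun y : lp (fun _ : ι => K) 2 => y i) (C_eq e)⟩
  exact (enorm_lp_sq (C x)).symm.trans_le
    (enorm_sq_le_enorm_sq_iff.2 (by simpa using C.le_of_opNorm_le C_le x))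

omit [CompleteSpace H] [CompleteSpace K] in
theorem IsSubKraus.exists_contraction {Y : ι → H →L[ℂ] K} (h : IsSubKraus Y) :
    ∃ T : H →L[ℂ] lp (fun _ : ι => K) 2, ‖T‖ ≤ 1 ∧ ∀ x, ‖T x‖ₑ ^ 2 = ∑' i, ‖Y i x‖ₑ ^ 2 := by
  have ne_top : ∀ x, ∑' i, ‖(Y i).toLinearMap x‖ₑ ^ 2 ≠ ∞ := fun x =>
    ne_top_of_le_ne_top (enorm_sq_ne_top _) (h x)
  refine ⟨(column _ ne_top).mkContinuous 1 fun x => ?_,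
    LinearMap.mkContinuous_norm_le _ zero_le_one _, enorm_column_sq ne_top⟩
  rw [one_mul]
  exact enorm_sq_le_enorm_sq_iff.1 ((enorm_column_sq ne_top x).trans_le (h x))

theorem quadForm_adjoint_comp_self (T : H →L[ℂ] K) (x : H) :
    quadForm (adjoint T ∘L T) x = ‖T x‖ₑ ^ 2 := by
  rw [quadForm, ContinuousLinearMap.comp_apply, ContinuousLinearMap.adjoint_inner_right,
    inner_self_eq_norm_sq_to_K, enorm_sq_eq_ofReal]
  norm_cast

theorem enorm_sqrt_adjoint_comp_self_sq (T : H →L[ℂ] K) (x : H) :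
    ‖CFC.sqrt (adjoint T ∘L T) x‖ₑ ^ 2 = ‖T x‖ₑ ^ 2 := by
  rw [← quadForm_eq_enorm_sqrt_sq T.isPositive_adjoint_comp_self, quadForm_adjoint_comp_self]

theorem IsSubKraus.exists_sqrt_sum {Y : ι → H →L[ℂ] K} (h : IsSubKraus Y) :
    ∃ X : H →L[ℂ] H, ∀ x, ∑' i, ‖Y i x‖ₑ ^ 2 = ‖X x‖ₑ ^ 2 := by
  obtain ⟨T, -, hT⟩ := h.exists_contraction
  exact ⟨_, fun x => ((enorm_sqrt_adjoint_comp_self_sq T x).trans (hT x)).symm⟩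

/-- `S` completes the family `Y` to the Kraus operators of a trace preserving operation:
`∑ i, (Y i)* Y i + S* S = 1`. -/
def IsComplement (Y : ι → H →L[ℂ] K) (S : H →L[ℂ] L) : Prop :=
  ∀ x, ∑' i, ‖Y i x‖ₑ ^ 2 + ‖S x‖ₑ ^ 2 = ‖x‖ₑ ^ 2

theorem isPositive_id_sub_adjoint_comp_self {T : H →L[ℂ] K} (h : ‖T‖ ≤ 1) :
    (ContinuousLinearMap.id ℂ H - adjoint T ∘L T).IsPositive :=
  isPositive_of_inner_nonneg fun x => by
    rw [sub_apply, inner_sub_right, ContinuousLinearMap.comp_apply,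
      ContinuousLinearMap.adjoint_inner_right, ContinuousLinearMap.id_apply,
      inner_self_eq_norm_sq_to_K, inner_self_eq_norm_sq_to_K, sub_nonneg]
    have norm_le : ‖T x‖ ≤ ‖x‖ := by simpa using T.le_of_opNorm_le h x
    exact_mod_cast pow_le_pow_left₀ (norm_nonneg _) norm_le 2

theorem IsSubKraus.exists_isComplement {Y : ι → H →L[ℂ] K} (h : IsSubKraus Y) :
    ∃ S : H →L[ℂ] H, IsComplement Y S := by
  obtain ⟨T, T_le, hT⟩ := h.exists_contraction
  have S_pos := isPositive_id_sub_adjoint_comp_self T_le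
  have T_pos := T.isPositive_adjoint_comp_self
  refine ⟨CFC.sqrt (.id ℂ H - adjoint T ∘L T), fun x => ?_⟩
  rw [← hT, ← quadForm_adjoint_comp_self, ← quadForm_eq_enorm_sqrt_sq S_pos, quadForm, quadForm,
    ← ENNReal.ofReal_add (Complex.nonneg_iff.1 (T_pos.inner_nonneg_right x)).1
      (Complex.nonneg_iff.1 (S_pos.inner_nonneg_right x)).1,
    ← Complex.add_re, ← inner_add_right, sub_apply, add_sub_cancel, ContinuousLinearMap.id_apply,
    inner_self_eq_norm_sq_to_K, enorm_sq_eq_ofReal]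
  norm_cast

theorem exists_polar_decomposition (T : H →L[ℂ] K) :
    ∃ W : H →L[ℂ] K, ‖W‖ ≤ 1 ∧ W ∘L CFC.sqrt (adjoint T ∘L T) = T ∧
      adjoint W ∘L T = CFC.sqrt (adjoint T ∘L T) := by
  set P := CFC.sqrt (adjoint T ∘L T)
  have norm_P : ∀ x, ‖P x‖ = ‖T x‖ := fun x =>
    enorm_sq_eq_enorm_sq_iff.1 (enorm_sqrt_adjoint_comp_self_sq T x)
  obtain ⟨W, W_le, W_eq⟩ := exists_contraction_comp_eq (R := P.toLinearMap) (T := T.toLinearMap)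
    fun e => (norm_P e).ge
  replace W_eq : ∀ x, W (P x) = T x := W_eq
  refine ⟨W, W_le, ContinuousLinearMap.ext W_eq, ContinuousLinearMap.ext fun x => ?_⟩
  have adjoint_W_le : ‖adjoint W (T x)‖ ≤ ‖P x‖ := by
    rw [norm_P]
    simpa using (adjoint W).le_of_opNorm_le ((adjoint.norm_map W).trans_le W_le) (T x)
  -- `‖W* T x - P x‖² = ‖W* T x‖² - 2 ‖T x‖² + ‖P x‖² ≤ 0`
  have norm_sub_sq_le : ‖adjoint W (T x) - P x‖ ^ 2 ≤ 0 := by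
    rw [@norm_sub_sq ℂ, ContinuousLinearMap.adjoint_inner_left, W_eq, inner_self_eq_norm_sq,
      ← norm_P]
    linarith [pow_le_pow_left₀ (norm_nonneg _) adjoint_W_le 2]
  exact sub_eq_zero.1 (norm_eq_zero.1 (pow_eq_zero_iff two_ne_zero |>.1
    (le_antisymm norm_sub_sq_le (by positivity))))

theorem adjoint_sqrt (T : H →L[ℂ] H) : adjoint (CFC.sqrt T) = CFC.sqrt T :=
  (isPositive_sqrt T).isSelfAdjoint.adjoint_eq

/-- With polar decompositions `T = W P` and `R T = U Z` take `N = (R W)* U` and `V = U W*`: then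
`V T N = U P N = U (R T)* U = U Z`. -/
theorem exists_contraction_comp_comp_eq {T : H →L[ℂ] K} :
    ∃ W : H →L[ℂ] K, ‖W‖ ≤ 1 ∧ ∀ R : K →L[ℂ] L, ∃ (N : H →L[ℂ] H) (V : K →L[ℂ] L),
      ‖V‖ ≤ 1 ∧ V ∘L T ∘L N = R ∘L T ∧ ∀ x, ‖adjoint N x‖ ≤ ‖R (W x)‖ := by
  obtain ⟨W, W_le, W_comp, adjoint_W_comp⟩ := exists_polar_decomposition T
  refine ⟨W, W_le, fun R => ?_⟩
  obtain ⟨U, U_le, U_comp, adjoint_U_comp⟩ := exists_polar_decomposition (R ∘L T)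
  have adjoint_U_le : ‖adjoint U‖ ≤ 1 := (adjoint.norm_map U).trans_le U_le
  have adjoint_W_le : ‖adjoint W‖ ≤ 1 := (adjoint.norm_map W).trans_le W_le
  refine ⟨adjoint (R ∘L W) ∘L U, U ∘L adjoint W, ?_, ?_, fun x => ?_⟩
  · exact (U.opNorm_comp_le _).trans (mul_le_one₀ U_le (norm_nonneg _) adjoint_W_le)
  · have adjoint_comp_U : adjoint (R ∘L T) ∘L U =
        CFC.sqrt (adjoint (R ∘L T) ∘L (R ∘L T)) := by
      rw [← adjoint_sqrt, ← adjoint_U_comp, ContinuousLinearMap.adjoint_comp (adjoint U),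
        ContinuousLinearMap.adjoint_adjoint]
    calc (U ∘L adjoint W) ∘L T ∘L adjoint (R ∘L W) ∘L U
        = U ∘L (adjoint W ∘L T) ∘L adjoint (R ∘L W) ∘L U := rfl
      _ = U ∘L adjoint (R ∘L W ∘L CFC.sqrt (adjoint T ∘L T)) ∘L U := by
        rw [adjoint_W_comp, ← ContinuousLinearMap.comp_assoc R,
          ContinuousLinearMap.adjoint_comp (R ∘L W), adjoint_sqrt]
        rfl
      _ = R ∘L T := by rw [W_comp, adjoint_comp_U, U_comp]
  · rw [ContinuousLinearMap.adjoint_comp, ContinuousLinearMap.adjoint_adjoint]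
    simpa using (adjoint U).le_of_opNorm_le adjoint_U_le (R (W x))

end Factorization

section Conjugation

variable {H K : Type*} [NormedAddCommGroup H] [InnerProductSpace ℂ H] [CompleteSpace H]
  [NormedAddCommGroup K] [InnerProductSpace ℂ K] [CompleteSpace K]

variable (H) in
/-- Complex conjugation with respect to `basis H`. -/
def basisConj : H ≃ₗᵢ⋆[ℂ] H :=
  (basis H).repr.trans ((starₗᵢ ℂ).trans (basis H).repr.symm)

theorem basisConj_basisConj (x : H) : basisConj H (basisConj H x) = x := by
  simp [basisConj]

theorem inner_basisConj_basisConj (x y : H) :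
    inner ℂ (basisConj H x) (basisConj H y) = inner ℂ y x := by
  rw [← (basis H).repr.inner_map_map, ← (basis H).repr.inner_map_map y x, lp.inner_eq_tsum,
    lp.inner_eq_tsum]
  refine tsum_congr fun i => ?_
  simp [basisConj, mul_comm]

/-- The complex conjugate of an operator, with respect to the conjugations `basisConj`. -/
def conjugateOp (X : H →L[ℂ] K) : H →L[ℂ] K :=
  (basisConj K : K →L⋆[ℂ] K) ∘SL X ∘SL (basisConj H : H →L⋆[ℂ] H)

theorem conjugateOp_apply (X : H →L[ℂ] K) (x : H) :
    conjugateOp X x = basisConj K (X (basisConj H x)) := rfl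

theorem adjoint_conjugateOp (X : H →L[ℂ] K) :
    adjoint (conjugateOp X) = conjugateOp (adjoint X) := by
  refine ((ContinuousLinearMap.eq_adjoint_iff _ _).2 fun x y => ?_).symm
  rw [conjugateOp_apply, conjugateOp_apply, ← inner_basisConj_basisConj, basisConj_basisConj,
    ContinuousLinearMap.adjoint_inner_right, ← inner_basisConj_basisConj _ x, basisConj_basisConj]

theorem conjugateOp_conjugateOp (X : H →L[ℂ] K) : conjugateOp (conjugateOp X) = X := by
  ext x
  rw [conjugateOp_apply, conjugateOp_apply, basisConj_basisConj, basisConj_basisConj]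

end Conjugation

section Kraus

universe u v

variable {ι : Type*} {A A₁ : Type u} {B B₁ : Type v}
variable [NormedAddCommGroup A] [InnerProductSpace ℂ A] [CompleteSpace A]
variable [NormedAddCommGroup A₁] [InnerProductSpace ℂ A₁] [CompleteSpace A₁]
variable [NormedAddCommGroup B] [InnerProductSpace ℂ B] [CompleteSpace B]
variable [NormedAddCommGroup B₁] [InnerProductSpace ℂ B₁] [CompleteSpace B₁]

/-- The operator from `B` to `A` corresponding to a vector of `A ⊗ B`; it sends `b` to the slice at
`basisConj b`, which makes it linear. -/
def operatorOfVector (x : HTensor A B) : B →L[ℂ] A :=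
  ContinuousLinearMap.apply ℂ A x ∘SL slice A ∘SL (basisConj B : B →L⋆[ℂ] B)

theorem operatorOfVector_apply (x : HTensor A B) (b : B) :
    operatorOfVector x b = slice A (basisConj B b) x := rfl

theorem operatorOfVector_injective :
    Function.Injective (operatorOfVector : HTensor A B → B →L[ℂ] A) := fun x y h =>
  ext_slice fun b => by
    rw [← basisConj_basisConj b, ← operatorOfVector_apply, h, operatorOfVector_apply]

theorem operatorOfVector_opTensor (X : A →L[ℂ] A₁) (Y : B →L[ℂ] B₁) (x : HTensor A B) :
    operatorOfVector (opTensor X Y x) = X ∘L operatorOfVector x ∘L conjugateOp (adjoint Y) := by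
  ext b
  simp only [operatorOfVector_apply, slice_opTensor, ContinuousLinearMap.comp_apply,
    conjugateOp_apply, basisConj_basisConj]

theorem exists_isSubKraus_opTensor_eq {x : HTensor A B} {ψ : ι → HTensor A₁ B}
    (h : ∀ b : B, ∑' i, ‖slice A₁ b (ψ i)‖ₑ ^ 2 ≤ ‖slice A b x‖ₑ ^ 2) :
    ∃ K : ι → A →L[ℂ] A₁, IsSubKraus K ∧
      ∀ i, opTensor (K i) (ContinuousLinearMap.id ℂ B) x = ψ i := by
  obtain ⟨K, K_sub, K_eq⟩ := exists_isSubKraus_comp_eq (R := (operatorOfVector x).toLinearMap)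
    (T := fun i => (operatorOfVector (ψ i)).toLinearMap) fun b => h (basisConj B b)
  refine ⟨K, K_sub, fun i => ext_slice fun b => ?_⟩
  have adjoint_id : adjoint (ContinuousLinearMap.id ℂ B) = ContinuousLinearMap.id ℂ B :=
    ContinuousLinearMap.adjoint_one
  rw [slice_opTensor, adjoint_id, ContinuousLinearMap.id_apply, ← basisConj_basisConj b]
  exact K_eq i (basisConj B b)

/-- Lo–Popescu: for the operator `T` of the vector `x` this is `V T N = R T`, up to complex
conjugation of `N`. -/
theorem IsSubKraus.exists_opTensor_eq {R : ι → A →L[ℂ] A₁} (hR : IsSubKraus R)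
    (x : HTensor A B) :
    ∃ (V : ι → A →L[ℂ] A₁) (N : ι → B →L[ℂ] B), (∀ i, ‖V i‖ ≤ 1) ∧ IsSubKraus N ∧
      ∀ i, opTensor (V i) (N i) x = opTensor (R i) (ContinuousLinearMap.id ℂ B) x := by
  obtain ⟨W, W_le, exists_comp_eq⟩ := exists_contraction_comp_comp_eq
    (T := operatorOfVector x) (L := A₁)
  choose n V V_le comp_eq norm_le using fun i => exists_comp_eq (R i)
  refine ⟨V, fun i => conjugateOp (adjoint (n i)), V_le, fun b => ?_,
    fun i => operatorOfVector_injective ?_⟩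
  · calc ∑' i, ‖conjugateOp (adjoint (n i)) b‖ₑ ^ 2 ≤ ∑' i, ‖R i (W (basisConj B b))‖ₑ ^ 2 :=
          ENNReal.tsum_le_tsum fun i => enorm_sq_le_enorm_sq_iff.2 <| by
            rw [conjugateOp_apply, LinearIsometryEquiv.norm_map]
            exact norm_le i _
      _ ≤ ‖W (basisConj B b)‖ₑ ^ 2 := hR _
      _ ≤ ‖b‖ₑ ^ 2 := enorm_sq_le_enorm_sq_iff.2 <| by
          simpa using W.le_of_opNorm_le W_le (basisConj B b)
  · have adjoint_id : adjoint (ContinuousLinearMap.id ℂ B) = ContinuousLinearMap.id ℂ B :=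
      ContinuousLinearMap.adjoint_one
    rw [operatorOfVector_opTensor, adjoint_conjugateOp, ContinuousLinearMap.adjoint_adjoint,
      conjugateOp_conjugateOp, comp_eq, operatorOfVector_opTensor, adjoint_id]
    ext b
    simp only [ContinuousLinearMap.comp_apply, conjugateOp_apply,
      ContinuousLinearMap.id_apply, basisConj_basisConj]

end Kraus

section Instruments

variable {ι κ H K L : Type*} [NormedAddCommGroup H] [InnerProductSpace ℂ H] [CompleteSpace H]
  [NormedAddCommGroup K] [InnerProductSpace ℂ K] [CompleteSpace K]
  [NormedAddCommGroup L] [InnerProductSpace ℂ L] [CompleteSpace L]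

theorem IsInstrument.comp_equiv {F : κ → Op H K} (hF : IsInstrument F) (e : ι ≃ κ) :
    IsInstrument fun i => F (e i) :=
  ⟨fun i => hF.1 (e i), fun ρ => e.hasSum_iff.2 (hF.2 ρ)⟩

theorem isTPCP_id : IsTPCP (LinearMap.id : Op H H) := ⟨fun _ _ hρ => hρ, fun _ => rfl⟩

theorem IsTPCP.isInstrument_single [DecidableEq ι] {E : Op H K} (hE : IsTPCP E) (i : ι) :
    IsInstrument (Pi.single i E : ι → Op H K) := by
  refine ⟨fun j => ?_, fun ρ => ?_⟩
  · by_cases hj : j = i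
    · subst hj
      simpa only [Pi.single_eq_same] using hE.1
    · simpa only [Pi.single_eq_of_ne hj] using isCP_zero
  · have h := hasSum_single (f := fun j => trace ((Pi.single i E : ι → Op H K) j ρ)) i
      fun j hj => by simp [hj, trace]
    simpa only [Pi.single_eq_same, hE.2] using h

theorem IsInstrument.bind {F : κ → Op H K} (hF : IsInstrument F) {P : κ → ι → Op K L}
    (hP : ∀ k, IsInstrument (P k)) {I : ι → Op H L}
    (hI : ∀ i ρ, HasSum (fun k => (P k i (F k ρ)).1) (I i ρ).1) : IsInstrument I := by
  refine isInstrument_iff_tsum_eTrace.2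
    ⟨fun i => isCP_of_hasSum (fun k => ((hP k).1 i).comp (hF.1 k)) (hI i), fun ρ hρ => ?_⟩
  have Fρ_pos k : (F k ρ).1.IsPositive := (hF.1 k).isPositive hρ
  calc ∑' i, eTrace (I i ρ).1 = ∑' i, ∑' k, eTrace (P k i (F k ρ)).1 :=
        tsum_congr fun i => eTrace_eq_tsum (hI i ρ) fun k => ((hP k).1 i).isPositive (Fρ_pos k)
    _ = ∑' k, ∑' i, eTrace (P k i (F k ρ)).1 := ENNReal.tsum_comm
    _ = ∑' k, eTrace (F k ρ).1 := tsum_congr fun k => (hP k).tsum_eTrace (Fρ_pos k)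
    _ = eTrace ρ.1 := hF.tsum_eTrace hρ

theorem hasSum_conjOp (S : H →L[ℂ] K) {ρ : ι → traceClass H} {σ : traceClass H}
    (h : HasSum (fun i => (ρ i).1) σ.1) : HasSum (fun i => (conjOp S (ρ i)).1) (conjOp S σ).1 :=
  (h.mapL ((ContinuousLinearMap.compL ℂ K H H).flip (adjoint S))).mapL
    (ContinuousLinearMap.compL ℂ K H K S)

/-- The measurement with Kraus operators `Y i`, continued by the instrument `F` after the
remaining Kraus operator `S`. It is meant for `S` a complement of `Y`. -/
def complete (Y : ι → H →L[ℂ] K) (S : H →L[ℂ] L) (F : κ → Op L K) : ι ⊕ κ → Op H K :=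
  Sum.elim (fun i => conjOp (Y i)) fun k => F k ∘ₗ conjOp S

theorem IsComplement.isInstrument_complete {Y : ι → H →L[ℂ] K} {S : H →L[ℂ] L}
    (h : IsComplement Y S) {F : κ → Op L K} (hF : IsInstrument F) :
    IsInstrument (complete Y S F) := by
  refine isInstrument_iff_tsum_eTrace.2 ⟨?_, fun ρ hρ => ?_⟩
  · rintro (i | k)
    exacts [isCP_conjOp _, (hF.1 k).comp (isCP_conjOp _)]
  · have decomp := isDecomposition_sqrt hρ
    calc ∑' j, eTrace (complete Y S F j ρ).1
        = ∑' i, eTrace (conjOp (Y i) ρ).1 + ∑' k, eTrace (F k (conjOp S ρ)).1 :=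
          Summable.tsum_sum ENNReal.summable ENNReal.summable
      _ = ∑' i, eTrace (conjOp (Y i) ρ).1 + eTrace (conjOp S ρ).1 := by
          rw [hF.tsum_eTrace ((isCP_conjOp S).isPositive hρ)]
      _ = eTrace ρ.1 := by
          simp only [eTrace_conjOp _ decomp]
          rw [decomp.eTrace_eq, ENNReal.tsum_comm, ← ENNReal.tsum_add]
          exact tsum_congr fun j => h _

omit [CompleteSpace H] [CompleteSpace K] [CompleteSpace L] in
theorem IsComplement.eq_zero {Y : ι → H →L[ℂ] K} {S : H →L[ℂ] L} (h : IsComplement Y S) {x : H}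
    (hx : ∑' i, ‖Y i x‖ₑ ^ 2 = ‖x‖ₑ ^ 2) : S x = 0 := by
  have hS := h x
  rw [hx] at hS
  simpa using (ENNReal.add_right_inj (enorm_sq_ne_top x)).1 (hS.trans (add_zero _).symm)

end Instruments

section Local

universe u v
variable {ι κ : Type*} {A A' A₁ : Type u} {B B' B₁ : Type v}
variable [NormedAddCommGroup A] [InnerProductSpace ℂ A] [CompleteSpace A]
variable [NormedAddCommGroup B] [InnerProductSpace ℂ B] [CompleteSpace B]
variable [NormedAddCommGroup A'] [InnerProductSpace ℂ A'] [CompleteSpace A']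
variable [NormedAddCommGroup B'] [InnerProductSpace ℂ B'] [CompleteSpace B']
variable [NormedAddCommGroup A₁] [InnerProductSpace ℂ A₁] [CompleteSpace A₁]
variable [NormedAddCommGroup B₁] [InnerProductSpace ℂ B₁] [CompleteSpace B₁]

theorem IsComplement.opTensor_id {Y : ι → A →L[ℂ] A'} {S : A →L[ℂ] A₁} (h : IsComplement Y S) :
    IsComplement (fun i => opTensor (Y i) (.id ℂ B)) (opTensor S (.id ℂ B)) := fun x => by
  simp only [← tsum_enorm_slice_sq (opTensor _ _ x), slice_opTensor_id]
  rw [ENNReal.tsum_comm, ← tsum_enorm_slice_sq x, ← ENNReal.tsum_add]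
  exact tsum_congr fun j => h _

theorem isTensorOp_id :
    IsTensorOp (LinearMap.id : Op (HTensor A B) (HTensor A B)) LinearMap.id LinearMap.id :=
  ⟨isTPCP_id.1, fun a b => (opTensor_ketbra a b).symm⟩

theorem isTensorOp_zero_left (G : Op B B') :
    IsTensorOp (0 : Op (HTensor A B) (HTensor A' B')) 0 G :=
  ⟨isCP_zero, fun _ _ => (opTensor_zero_left _).symm⟩

theorem IsTensorOp.comp_conjOp {F : Op (HTensor A₁ B₁) (HTensor A' B')} {E : Op A₁ A'}
    {G : Op B₁ B'} (h : IsTensorOp F E G) (X : A →L[ℂ] A₁) (Y : B →L[ℂ] B₁) :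
    IsTensorOp (F ∘ₗ conjOp (opTensor X Y)) (E ∘ₗ conjOp X) (G ∘ₗ conjOp Y) :=
  ⟨h.1.comp (isCP_conjOp _), fun a b => by
    simp only [LinearMap.comp_apply, conjOp_ketbra, opTensor_tens]
    exact h.2 (X a) (Y b)⟩

theorem IsTensorOp.comp_conjOp_id {F : Op (HTensor A₁ B) (HTensor A' B')} {E : Op A₁ A'}
    {G : Op B B'} (h : IsTensorOp F E G) (X : A →L[ℂ] A₁) :
    IsTensorOp (F ∘ₗ conjOp (opTensor X (.id ℂ B))) (E ∘ₗ conjOp X) G := by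
  simpa only [conjOp_id, LinearMap.comp_id] using h.comp_conjOp X (.id ℂ B)

theorem isTensorOp_complete (Y : ι → A →L[ℂ] A') (S : A →L[ℂ] A₁)
    {F : κ → Op (HTensor A₁ B) (HTensor A' B)} {J : κ → Op A₁ A'}
    (h : ∀ k, IsTensorOp (F k) (J k) LinearMap.id) (j : ι ⊕ κ) :
    IsTensorOp (complete (fun i => opTensor (Y i) (.id ℂ B)) (opTensor S (.id ℂ B)) F j)
      (complete Y S J j) LinearMap.id := by
  rcases j with i | k
  exacts [isTensorOp_id.comp_conjOp_id (Y i), (h k).comp_conjOp_id S]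

theorem IsLocalAlice.complete {Y : ι → A →L[ℂ] A'} {S : A →L[ℂ] A₁} (h : IsComplement Y S)
    {F : ℕ → Op (HTensor A₁ B) (HTensor A' B)} (hF : IsLocalAlice F) (e : ℕ ≃ ι ⊕ ℕ) :
    IsLocalAlice fun n => complete (fun i => opTensor (Y i) (.id ℂ B))
      (opTensor S (.id ℂ B)) F (e n) := by
  obtain ⟨F_instr, J, J_instr, F_eq⟩ := hF
  exact ⟨(h.opTensor_id.isInstrument_complete F_instr).comp_equiv e, _,
    (h.isInstrument_complete J_instr).comp_equiv e, fun n => isTensorOp_complete Y S F_eq (e n)⟩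

theorem isLocalAlice_single_id :
    IsLocalAlice (Pi.single 0 LinearMap.id : ℕ → Op (HTensor A B) (HTensor A B)) := by
  refine ⟨isTPCP_id.isInstrument_single 0, Pi.single 0 LinearMap.id,
    isTPCP_id.isInstrument_single 0, fun k => ?_⟩
  by_cases hk : k = 0
  · subst hk
    simpa only [Pi.single_eq_same] using isTensorOp_id
  · simpa only [Pi.single_eq_of_ne hk] using isTensorOp_zero_left LinearMap.id

end Local

section Swap

universe u v w
variable {Ω : Type w} {A A₁ A' : Type u} {B B₁ B' : Type v}
variable [NormedAddCommGroup A] [InnerProductSpace ℂ A]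
variable [NormedAddCommGroup B] [InnerProductSpace ℂ B]
variable [NormedAddCommGroup A₁] [InnerProductSpace ℂ A₁]
variable [NormedAddCommGroup B₁] [InnerProductSpace ℂ B₁]
variable [NormedAddCommGroup A'] [InnerProductSpace ℂ A']
variable [NormedAddCommGroup B'] [InnerProductSpace ℂ B']

/-- The operation `E` with the roles of Alice and Bob exchanged. -/
def swapOp (E : Op (HTensor A B) (HTensor A' B')) : Op (HTensor B A) (HTensor B' A') :=
  conjOp swap ∘ₗ E ∘ₗ conjOp swap

theorem swapOp_apply (E : Op (HTensor A B) (HTensor A' B')) (ρ : traceClass (HTensor B A)) :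
    swapOp E ρ = conjOp swap (E (conjOp swap ρ)) := rfl

theorem conjOp_swap_conjOp_swap (ρ : traceClass (HTensor A B)) :
    conjOp swap (conjOp swap ρ) = ρ := by
  refine Subtype.ext (ContinuousLinearMap.ext fun x => ?_)
  simp only [conjOp_apply, adjoint_swap, ContinuousLinearMap.comp_apply, swap_swap]

theorem IsInstrument.swapOp {F : Ω → Op (HTensor A B) (HTensor A' B')} (hF : IsInstrument F) :
    IsInstrument fun k => swapOp (F k) :=
  (hF.precomp (isTPCP_conjOp norm_swap)).postcomp fun _ => isTPCP_conjOp norm_swap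

theorem IsTPCP.swapOp {E : Op (HTensor A B) (HTensor A' B')} (hE : IsTPCP E) :
    IsTPCP (swapOp E) :=
  (isTPCP_conjOp norm_swap).comp (hE.comp (isTPCP_conjOp norm_swap))

theorem hasSum_swapOp {ι : Type*} {F : ι → Op (HTensor A B) (HTensor A₁ B₁)}
    {P : ι → Op (HTensor A₁ B₁) (HTensor A' B')} {E : Op (HTensor A B) (HTensor A' B')}
    (h : ∀ ρ, HasSum (fun k => (P k (F k ρ)).1) (E ρ).1) (ρ : traceClass (HTensor B A)) :
    HasSum (fun k => (swapOp (P k) (swapOp (F k) ρ)).1) (swapOp E ρ).1 := by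
  simp only [swapOp_apply, conjOp_swap_conjOp_swap]
  exact hasSum_conjOp swap (h _)

variable [CompleteSpace A] [CompleteSpace B] [CompleteSpace A'] [CompleteSpace B']

theorem IsTensorOp.swapOp {F : Op (HTensor A B) (HTensor A' B')} {E : Op A A'} {G : Op B B'}
    (h : IsTensorOp F E G) : IsTensorOp (swapOp F) G E := by
  refine ⟨(isCP_conjOp _).comp (h.1.comp (isCP_conjOp _)), fun b a =>
    ContinuousLinearMap.ext fun x => ?_⟩
  rw [swapOp_apply, conjOp_ketbra, swap_tens, conjOp_apply, h.2, adjoint_swap,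
    ContinuousLinearMap.comp_apply, ContinuousLinearMap.comp_apply, swap_opTensor, swap_swap]

theorem IsLocalAlice.swapOp {F : ℕ → Op (HTensor A B) (HTensor A' B)} (hF : IsLocalAlice F) :
    IsLocalBob fun k => swapOp (F k) :=
  let ⟨F_instr, J, J_instr, F_eq⟩ := hF
  ⟨F_instr.swapOp, J, J_instr, fun k => (F_eq k).swapOp⟩

theorem IsLocalBob.swapOp {F : ℕ → Op (HTensor A B) (HTensor A B')} (hF : IsLocalBob F) :
    IsLocalAlice fun k => swapOp (F k) :=
  let ⟨F_instr, J, J_instr, F_eq⟩ := hF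
  ⟨F_instr.swapOp, J, J_instr, fun k => (F_eq k).swapOp⟩

end Swap

section Rounds

universe u v w
variable {Ω : Type w} {A A' : Type u} {B B' : Type v}
variable [NormedAddCommGroup A] [InnerProductSpace ℂ A] [CompleteSpace A]
variable [NormedAddCommGroup B] [InnerProductSpace ℂ B] [CompleteSpace B]
variable [NormedAddCommGroup A'] [InnerProductSpace ℂ A'] [CompleteSpace A']
variable [NormedAddCommGroup B'] [InnerProductSpace ℂ B'] [CompleteSpace B']

theorem IsLOCCRounds.swapOp {n : ℕ} {I : Ω → Op (HTensor A B) (HTensor A' B')}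
    (h : IsLOCCRounds A' B' n A B I) : IsLOCCRounds B' A' n B A fun ω => swapOp (I ω) := by
  induction n generalizing A B with
  | zero =>
    obtain ⟨ω₀, E, G, hE, hG, I_tpcp, I_eq, I_zero⟩ := h
    refine ⟨ω₀, G, E, hG, hE, I_tpcp.swapOp, I_eq.swapOp, fun ω hω => ?_⟩
    simp only [I_zero ω hω, LOCC.swapOp, LinearMap.zero_comp, LinearMap.comp_zero]
  | succ n ih =>
    rcases h with ⟨A₁, _, _, _, F, P, hF, hP, h⟩ | ⟨B₁, _, _, _, F, P, hF, hP, h⟩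
    · exact .inr ⟨A₁, _, _, _, _, _, hF.swapOp, fun k => ih (hP k), fun ω => hasSum_swapOp (h ω)⟩
    · exact .inl ⟨B₁, _, _, _, _, _, hF.swapOp, fun k => ih (hP k), fun ω => hasSum_swapOp (h ω)⟩

theorem IsLOCCRounds.isInstrument {n : ℕ} {I : Ω → Op (HTensor A B) (HTensor A' B')}
    (h : IsLOCCRounds A' B' n A B I) : IsInstrument I := by
  classical
  induction n generalizing A B with
  | zero =>
    obtain ⟨ω₀, E, G, -, -, I_tpcp, -, I_zero⟩ := h
    have I_eq : I = Pi.single ω₀ (I ω₀) := by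
      ext1 ω
      by_cases hω : ω = ω₀
      · rw [hω, Pi.single_eq_same]
      · rw [I_zero ω hω, Pi.single_eq_of_ne hω]
    exact I_eq ▸ I_tpcp.isInstrument_single ω₀
  | succ n ih =>
    rcases h with ⟨A₁, _, _, _, F, P, hF, hP, h⟩ | ⟨B₁, _, _, _, F, P, hF, hP, h⟩
    exacts [hF.1.bind (fun k => ih (hP k)) h, hF.1.bind (fun k => ih (hP k)) h]

theorem IsLOCCRounds.isTPCP {n : ℕ} {C : Op (HTensor A B) (HTensor A' B')}
    (h : IsLOCCRounds A' B' n A B fun _ : Unit => C) : IsTPCP C :=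
  isInstrument_unit_iff.1 h.isInstrument

theorem IsLOCCRounds.nonempty {n : ℕ} {I : Ω → Op (HTensor A B) (HTensor A' B')}
    (h : IsLOCCRounds A' B' n A B I) : Nonempty Ω := by
  induction n generalizing A B with
  | zero => exact ⟨h.choose⟩
  | succ n ih =>
    rcases h with ⟨A₁, _, _, _, F, P, -, hP, -⟩ | ⟨B₁, _, _, _, F, P, -, hP, -⟩
    exacts [ih (hP 0), ih (hP 0)]

theorem IsLOCCRounds.succ {n : ℕ} {I : Ω → Op (HTensor A B) (HTensor A' B')}
    (h : IsLOCCRounds A' B' n A B I) : IsLOCCRounds A' B' (n + 1) A B I := by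
  refine .inl ⟨A, _, _, _, _, fun _ => I, isLocalAlice_single_id, fun _ => h, fun ω ρ => ?_⟩
  simpa only [Pi.single_eq_same, LinearMap.id_apply] using
    hasSum_single (f := fun k => (I ω ((Pi.single 0 LinearMap.id : ℕ → Op _ _) k ρ)).1) 0
      fun k hk => by simp [hk]

end Rounds

section Decompositions

variable {ι κ H K L : Type*} [NormedAddCommGroup H] [InnerProductSpace ℂ H] [CompleteSpace H]
  [NormedAddCommGroup K] [InnerProductSpace ℂ K] [CompleteSpace K]
  [NormedAddCommGroup L] [InnerProductSpace ℂ L] [CompleteSpace L]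

theorem ketbra_zero : ketbra (0 : H) = 0 := Subtype.ext (by simp [ketbra])

theorem IsInstrument.tsum_enorm_decomposition_sq {F : κ → Op H K} (hF : IsInstrument F) {x : H}
    {ψ : κ → ι → K} (hψ : ∀ k, IsDecomposition (F k (ketbra x)).1 (ψ k)) :
    ∑' i : κ × ι, ‖ψ i.1 i.2‖ₑ ^ 2 = ‖x‖ₑ ^ 2 := by
  rw [ENNReal.tsum_prod', ← eTrace_ketbra, ← hF.tsum_eTrace (ketbra_isPositive x)]
  exact tsum_congr fun k => (hψ k).eTrace_eq.symm

theorem IsInstrument.hasSum_ketbra_decomposition {F : κ → Op H K} (hF : IsInstrument F)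
    {P : κ → Op K L} (hP : ∀ k, IsBoundedPositive (P k) 1) {x : H} {ψ : κ → ι → K}
    (hψ : ∀ k, IsDecomposition (F k (ketbra x)).1 (ψ k)) {T : L →L[ℂ] L}
    (hT : HasSum (fun k => (P k (F k (ketbra x))).1) T) :
    HasSum (fun i : κ × ι => (P i.1 (ketbra (ψ i.1 i.2))).1) T := by
  have bounds (i : κ × ι) := hP i.1 (ketbra (ψ i.1 i.2)) (ketbra_isPositive _)
  have summable : Summable fun i : κ × ι => (P i.1 (ketbra (ψ i.1 i.2))).1 := by
    refine summable_of_tsum_eTrace (fun i => (bounds i).1)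
      (ne_top_of_le_ne_top (enorm_sq_ne_top x) ?_)
    rw [← hF.tsum_enorm_decomposition_sq hψ]
    exact ENNReal.tsum_le_tsum fun i => by simpa [eTrace_ketbra] using (bounds i).2
  have fiberwise := summable.hasSum.prod_fiberwise fun k =>
    (hP k).hasSum_ketbra ((hF.1 k).isPositive (ketbra_isPositive x)) (hψ k)
  exact hT.unique fiberwise ▸ summable.hasSum

theorem IsComplement.hasSum_of_hasSum_complete {Y : ι → H →L[ℂ] K} {S : H →L[ℂ] H}
    (h : IsComplement Y S) {F : κ → Op H K} {P : ι ⊕ κ → Op K L} {x : H}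
    (hx : ∑' i, ‖Y i x‖ₑ ^ 2 = ‖x‖ₑ ^ 2) {T : L →L[ℂ] L}
    (hT : HasSum (fun j => (P j (complete Y S F j (ketbra x))).1) T) :
    HasSum (fun i => (P (.inl i) (ketbra (Y i x))).1) T := by
  rw [← Sum.inl_injective.hasSum_iff] at hT
  · simpa only [Function.comp_def, complete, Sum.elim_inl, conjOp_ketbra] using hT
  · rintro (i | k) hk
    · exact absurd ⟨i, rfl⟩ hk
    · simp [complete, conjOp_ketbra, h.eq_zero hx, ketbra_zero]

omit [CompleteSpace H] [CompleteSpace K] in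
theorem isSubKraus_of_norm_le_one {V : H →L[ℂ] K} (hV : ‖V‖ ≤ 1) :
    IsSubKraus fun _ : Unit => V := fun x => by
  simpa [enorm_sq_le_enorm_sq_iff] using V.le_of_opNorm_le hV x

theorem eq_of_le_of_tsum_le {f g : ι → ℝ≥0∞} (h : ∀ i, f i ≤ g i) (hs : ∑' i, g i ≤ ∑' i, f i)
    (hf : ∑' i, f i ≠ ∞) : f = g := by
  by_contra hne
  obtain ⟨i, hi⟩ := Function.ne_iff.1 hne
  exact (ENNReal.tsum_lt_tsum hf h ((h i).lt_of_ne hi)).not_ge hs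

end Decompositions

section Simulation

universe u v w
variable {ι : Type*} {Ω : Type w} {A A₁ A' : Type u} {B B₁ B' : Type v}
variable [NormedAddCommGroup A] [InnerProductSpace ℂ A] [CompleteSpace A]
variable [NormedAddCommGroup B] [InnerProductSpace ℂ B] [CompleteSpace B]
variable [NormedAddCommGroup A₁] [InnerProductSpace ℂ A₁] [CompleteSpace A₁]
variable [NormedAddCommGroup B₁] [InnerProductSpace ℂ B₁] [CompleteSpace B₁]
variable [NormedAddCommGroup A'] [InnerProductSpace ℂ A'] [CompleteSpace A']
variable [NormedAddCommGroup B'] [InnerProductSpace ℂ B'] [CompleteSpace B']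

theorem IsSubKraus.tsum_enorm_opTensor_id_sq_le {K : ι → A →L[ℂ] A₁} (hK : IsSubKraus K)
    (x : HTensor A B) : ∑' i, ‖opTensor (K i) (.id ℂ B) x‖ₑ ^ 2 ≤ ‖x‖ₑ ^ 2 := by
  simpa only [opTensor_id, ContinuousLinearMap.id_apply] using
    LOCC.tsum_enorm_opTensor_id_sq_le (X := .id ℂ A) hK x

theorem norm_opTensor_id_le {V : B →L[ℂ] B₁} (hV : ‖V‖ ≤ 1) (x : HTensor A B) :
    ‖opTensor (.id ℂ A) V x‖ ≤ ‖x‖ := by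
  have h := (isSubKraus_of_norm_le_one hV).tsum_enorm_opTensor_id_sq_le (swap x)
  rw [tsum_fintype, Fintype.sum_unique, enorm_sq_le_enorm_sq_iff, opTensor_swap, norm_swap,
    norm_swap] at h
  exact h

omit [CompleteSpace A] [CompleteSpace B] [CompleteSpace A₁] [CompleteSpace A'] in
theorem opTensor_id_opTensor_id (X : A →L[ℂ] A₁) (Y : A₁ →L[ℂ] A') (x : HTensor A B) :
    opTensor Y (.id ℂ B) (opTensor X (.id ℂ B) x) = opTensor (Y ∘L X) (.id ℂ B) x :=
  opTensor_opTensor X Y _ _ x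

omit [CompleteSpace A] [CompleteSpace B] [CompleteSpace A₁] [CompleteSpace B₁] in
theorem opTensor_id_right_left (X : A →L[ℂ] A₁) (V : B →L[ℂ] B₁) (x : HTensor A B) :
    opTensor (.id ℂ A₁) V (opTensor X (.id ℂ B) x) = opTensor X V x :=
  opTensor_opTensor X _ _ V x

omit [CompleteSpace A] [CompleteSpace B] [CompleteSpace A₁] [CompleteSpace B₁] in
theorem opTensor_id_left_right (X : A →L[ℂ] A₁) (V : B →L[ℂ] B₁) (x : HTensor A B) :
    opTensor X (.id ℂ B₁) (opTensor (.id ℂ A) V x) = opTensor X V x :=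
  opTensor_opTensor _ X V _ x

theorem IsSubKraus.exists_isLOCCRounds [Countable ι] [Nonempty ι] {m : ℕ} {K : ι → A →L[ℂ] A₁}
    (hK : IsSubKraus K) {F : ℕ → Op (HTensor A B) (HTensor A₁ B)} (hF : IsLocalAlice F)
    {D : ι → Op (HTensor A₁ B) (HTensor A' B')}
    (hD : ∀ i, IsLOCCRounds A' B' m A₁ B fun _ : Unit => D i) :
    ∃ C : Op (HTensor A B) (HTensor A' B'), IsLOCCRounds A' B' (m + 1) A B (fun _ : Unit => C) ∧
      ∀ x, ∑' i, ‖opTensor (K i) (.id ℂ B) x‖ₑ ^ 2 = ‖x‖ₑ ^ 2 →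
        HasSum (fun i => (D i (ketbra (opTensor (K i) (.id ℂ B) x))).1) (C (ketbra x)).1 := by
  obtain ⟨S, hS⟩ := hK.exists_isComplement
  let e : ℕ ≃ ι ⊕ ℕ := Classical.choice nonempty_equiv_of_countable
  let P : ι ⊕ ℕ → Op (HTensor A₁ B) (HTensor A' B') :=
    Sum.elim D fun _ => D (Classical.arbitrary ι)
  have P_locc j : IsLOCCRounds A' B' m A₁ B fun _ : Unit => P j := by
    rcases j with _ | _
    exacts [hD _, hD _]
  have complete_local := hF.complete hS e
  obtain ⟨C, -, hC⟩ := (complete_local.1.postcomp fun n => (P_locc (e n)).isTPCP).exists_hasSum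
  refine ⟨C, .inl ⟨A₁, _, _, _, _, fun n _ => P (e n), complete_local, fun n => P_locc _,
    fun _ => hC⟩, fun x hx => ?_⟩
  exact hS.opTensor_id.hasSum_of_hasSum_complete (P := P) hx (e.hasSum_iff.1 (hC (ketbra x)))

theorem exists_isLOCCRounds_contraction_alice {m : ℕ} {V : A →L[ℂ] A₁} (hV : ‖V‖ ≤ 1)
    {F : ℕ → Op (HTensor A B) (HTensor A₁ B)} (hF : IsLocalAlice F)
    {D : Op (HTensor A₁ B) (HTensor A' B')} (hD : IsLOCCRounds A' B' m A₁ B fun _ : Unit => D) :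
    ∃ C : Op (HTensor A B) (HTensor A' B'), IsLOCCRounds A' B' (m + 1) A B (fun _ : Unit => C) ∧
      ∀ x, ‖opTensor V (.id ℂ B) x‖ = ‖x‖ →
        C (ketbra x) = D (ketbra (opTensor V (.id ℂ B) x)) := by
  obtain ⟨C, C_locc, hC⟩ := (isSubKraus_of_norm_le_one hV).exists_isLOCCRounds hF fun _ => hD
  refine ⟨C, C_locc, fun x hx => Subtype.ext ((hC x ?_).unique (hasSum_unique _))⟩
  rw [tsum_fintype, Fintype.sum_unique, ← ofReal_norm, hx, ofReal_norm]

theorem exists_isLOCCRounds_contraction_bob {m : ℕ} {V : B →L[ℂ] B₁} (hV : ‖V‖ ≤ 1)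
    {F : ℕ → Op (HTensor A B) (HTensor A B₁)} (hF : IsLocalBob F)
    {D : Op (HTensor A B₁) (HTensor A' B')} (hD : IsLOCCRounds A' B' m A B₁ fun _ : Unit => D) :
    ∃ C : Op (HTensor A B) (HTensor A' B'), IsLOCCRounds A' B' (m + 1) A B (fun _ : Unit => C) ∧
      ∀ x, ‖opTensor (.id ℂ A) V x‖ = ‖x‖ →
        C (ketbra x) = D (ketbra (opTensor (.id ℂ A) V x)) := by
  obtain ⟨C, C_locc, hC⟩ := exists_isLOCCRounds_contraction_alice hV hF.swapOp hD.swapOp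
  refine ⟨swapOp C, C_locc.swapOp, fun x hx => ?_⟩
  rw [swapOp_apply, conjOp_ketbra, hC, opTensor_swap, swapOp_apply, conjOp_ketbra, swap_swap,
    conjOp_swap_conjOp_swap]
  rw [opTensor_swap, norm_swap, norm_swap, hx]

/-- The unnormalized states `T ω` can be prepared from the state vector `x` by a measurement of
Alice with one Kraus operator `X ω` for each `ω`, followed by LOCC operations with `m` rounds. -/
def IsSimulable (m : ℕ) (x : HTensor A B) (T : Ω → traceClass (HTensor A' B')) : Prop :=
  ∃ (X : Ω → A →L[ℂ] A) (C : Ω → Op (HTensor A B) (HTensor A' B')), IsSubKraus X ∧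
    ∑' ω, ‖opTensor (X ω) (.id ℂ B) x‖ₑ ^ 2 = ‖x‖ₑ ^ 2 ∧
    ∀ ω, IsLOCCRounds A' B' m A B (fun _ : Unit => C ω) ∧
      T ω = C ω (ketbra (opTensor (X ω) (.id ℂ B) x))

theorem IsSimulable.succ {m : ℕ} {x : HTensor A B} {T : Ω → traceClass (HTensor A' B')}
    (h : IsSimulable m x T) : IsSimulable (m + 1) x T :=
  let ⟨X, C, X_sub, X_norm, hC⟩ := h
  ⟨X, C, X_sub, X_norm, fun ω => ⟨(hC ω).1.succ, (hC ω).2⟩⟩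

/-- A measurement `K` followed by the measurements `Y i` of the outcomes `i` has the Kraus operators
`Y i ω ∘ K i`; those with the same `ω` are merged into `X ω = (∑ i, |Y i ω ∘ K i|²)^(1/2)`. -/
theorem IsSubKraus.isSimulable [Countable ι] [Nonempty ι] {m : ℕ} {x : HTensor A B}
    {K : ι → A →L[ℂ] A₁} (hK : IsSubKraus K)
    (hx : ∑' i, ‖opTensor (K i) (.id ℂ B) x‖ₑ ^ 2 = ‖x‖ₑ ^ 2)
    {F : ℕ → Op (HTensor A B) (HTensor A₁ B)} (hF : IsLocalAlice F)
    {T : ι → Ω → traceClass (HTensor A' B')}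
    (hT : ∀ i, IsSimulable m (opTensor (K i) (.id ℂ B) x) (T i))
    {T' : Ω → traceClass (HTensor A' B')} (hT' : ∀ ω, HasSum (fun i => (T i ω).1) (T' ω).1) :
    IsSimulable (m + 1) x T' := by
  choose Y D Y_sub Y_norm hD using hT
  have tsum_le a : ∑' ω, ∑' i, ‖(Y i ω ∘L K i) a‖ₑ ^ 2 ≤ ‖a‖ₑ ^ 2 := by
    rw [ENNReal.tsum_comm]
    exact (ENNReal.tsum_le_tsum fun i => Y_sub i (K i a)).trans (hK a)
  choose X hX using fun ω => IsSubKraus.exists_sqrt_sum (Y := fun i => Y i ω ∘L K i)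
    fun a => (ENNReal.le_tsum ω).trans (tsum_le a)
  choose L L_sub L_X using fun ω => exists_isSubKraus_comp_eq (R := (X ω).toLinearMap)
    (T := fun i => (Y i ω ∘L K i).toLinearMap) fun a => (hX ω a).le
  choose C C_locc C_sum using fun ω => (L_sub ω).exists_isLOCCRounds hF fun i => (hD i ω).1
  have L_X_tensor ω i : opTensor (L ω i) (.id ℂ B) (opTensor (X ω) (.id ℂ B) x) =
      opTensor (Y i ω) (.id ℂ B) (opTensor (K i) (.id ℂ B) x) := by
    rw [opTensor_id_opTensor_id, opTensor_id_opTensor_id]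
    exact congrArg (opTensor · _ x) (ContinuousLinearMap.ext (L_X ω i))
  have X_norm ω : ∑' i, ‖opTensor (Y i ω) (.id ℂ B) (opTensor (K i) (.id ℂ B) x)‖ₑ ^ 2 =
      ‖opTensor (X ω) (.id ℂ B) x‖ₑ ^ 2 := by
    simp only [opTensor_id_opTensor_id]
    exact tsum_enorm_opTensor_id_sq_eq (hX ω) x
  refine ⟨X, C, fun a => by simpa only [← hX] using tsum_le a, ?_, fun ω =>
    ⟨C_locc ω, Subtype.ext ?_⟩⟩
  · simp only [← X_norm]
    rw [ENNReal.tsum_comm, ← hx]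
    exact tsum_congr Y_norm
  · have h := C_sum ω (opTensor (X ω) (.id ℂ B) x)
    simp only [L_X_tensor, ← (hD _ ω).2] at h
    exact (hT' ω).unique (h (X_norm ω))

theorem IsSimulable.of_contraction_bob {m : ℕ} {V : B →L[ℂ] B₁} (hV : ‖V‖ ≤ 1)
    {F : ℕ → Op (HTensor A B) (HTensor A B₁)} (hF : IsLocalBob F) {x : HTensor A B}
    (hx : ‖opTensor (.id ℂ A) V x‖ = ‖x‖) {T : Ω → traceClass (HTensor A' B')}
    (h : IsSimulable m (opTensor (.id ℂ A) V x) T) : IsSimulable (m + 1) x T := by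
  obtain ⟨X, D, X_sub, X_norm, hD⟩ := h
  have comm ω : opTensor (X ω) (.id ℂ B₁) (opTensor (.id ℂ A) V x) =
      opTensor (.id ℂ A) V (opTensor (X ω) (.id ℂ B) x) := by
    rw [opTensor_id_left_right, opTensor_id_right_left]
  simp only [comm] at X_norm hD
  replace X_norm := X_norm.trans (congrArg (· ^ 2) (enorm_eq_iff_norm_eq.2 hx))
  have enorm_eq := eq_of_le_of_tsum_le
    (fun ω => enorm_sq_le_enorm_sq_iff.2 (norm_opTensor_id_le hV (opTensor (X ω) (.id ℂ B) x)))
    (X_norm ▸ X_sub.tsum_enorm_opTensor_id_sq_le x) (X_norm ▸ enorm_sq_ne_top x)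
  choose C C_locc C_eq using fun ω => exists_isLOCCRounds_contraction_bob hV hF (hD ω).1
  refine ⟨X, C, X_sub, by rw [← X_norm, enorm_eq], fun ω => ⟨C_locc ω, ?_⟩⟩
  rw [(hD ω).2, C_eq ω _ (enorm_sq_eq_enorm_sq_iff.1 (congrFun enorm_eq ω))]

theorem IsLocalAlice.exists_isSubKraus_opTensor_eq
    {F : ℕ → Op (HTensor A B) (HTensor A₁ B)} (hF : IsLocalAlice F) {x : HTensor A B}
    {ψ : ℕ → ι → HTensor A₁ B} (hψ : ∀ k, IsDecomposition (F k (ketbra x)).1 (ψ k)) :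
    ∃ K : ℕ × ι → A →L[ℂ] A₁, IsSubKraus K ∧
      ∀ i, opTensor (K i) (.id ℂ B) x = ψ i.1 i.2 :=
  LOCC.exists_isSubKraus_opTensor_eq fun b => by
    rw [ENNReal.tsum_prod', hF.tsum_enorm_slice_sq x hψ b]

theorem IsLocalBob.exists_opTensor_eq {F : ℕ → Op (HTensor A B) (HTensor A B₁)}
    (hF : IsLocalBob F) {x : HTensor A B} {ψ : ℕ → ι → HTensor A B₁}
    (hψ : ∀ k, IsDecomposition (F k (ketbra x)).1 (ψ k)) :
    ∃ (N : ℕ × ι → A →L[ℂ] A) (V : ℕ × ι → B →L[ℂ] B₁), IsSubKraus N ∧ (∀ i, ‖V i‖ ≤ 1) ∧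
      ∀ i, opTensor (N i) (V i) x = ψ i.1 i.2 := by
  have swap_decomp k :
      IsDecomposition (LOCC.swapOp (F k) (ketbra (swap x))).1 fun j => swap (ψ k j) := by
    rw [swapOp_apply, conjOp_ketbra, swap_swap]
    exact (hψ k).conj swap
  obtain ⟨R, R_sub, R_eq⟩ := hF.swapOp.exists_isSubKraus_opTensor_eq swap_decomp
  obtain ⟨V, N, V_le, N_sub, VN_eq⟩ := R_sub.exists_opTensor_eq (swap x)
  refine ⟨N, V, N_sub, V_le, fun i => ?_⟩
  rw [← swap_swap (opTensor _ _ x), swap_opTensor, VN_eq, R_eq, swap_swap]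

theorem IsLocalAlice.isSimulable {m : ℕ} {x : HTensor A B}
    {F : ℕ → Op (HTensor A B) (HTensor A₁ B)} (hF : IsLocalAlice F)
    {P : ℕ → Ω → Op (HTensor A₁ B) (HTensor A' B')} (hP : ∀ k ω, IsBoundedPositive (P k ω) 1)
    (hPx : ∀ k y, IsSimulable m y fun ω => P k ω (ketbra y))
    {T : Ω → traceClass (HTensor A' B')}
    (hT : ∀ ω, HasSum (fun k => (P k ω (F k (ketbra x))).1) (T ω).1) :
    IsSimulable (m + 1) x T := by
  choose ψ hψ using fun k =>
    exists_nat_isDecomposition ((hF.1.1 k).isPositive (ketbra_isPositive x))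
  obtain ⟨K, K_sub, K_eq⟩ := hF.exists_isSubKraus_opTensor_eq hψ
  refine K_sub.isSimulable ?_ hF (fun i => K_eq i ▸ hPx i.1 (ψ i.1 i.2)) fun ω =>
    hF.1.hasSum_ketbra_decomposition (fun k => hP k ω) hψ (hT ω)
  simpa only [K_eq] using hF.1.tsum_enorm_decomposition_sq hψ

theorem IsLocalBob.isSimulable {m : ℕ} {x : HTensor A B}
    {F : ℕ → Op (HTensor A B) (HTensor A B₁)} (hF : IsLocalBob F)
    {P : ℕ → Ω → Op (HTensor A B₁) (HTensor A' B')} (hP : ∀ k ω, IsBoundedPositive (P k ω) 1)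
    (hPx : ∀ k y, IsSimulable m y fun ω => P k ω (ketbra y))
    {T : Ω → traceClass (HTensor A' B')}
    (hT : ∀ ω, HasSum (fun k => (P k ω (F k (ketbra x))).1) (T ω).1) :
    IsSimulable (m + 2) x T := by
  choose ψ hψ using fun k =>
    exists_nat_isDecomposition ((hF.1.1 k).isPositive (ketbra_isPositive x))
  obtain ⟨N, V, N_sub, V_le, NV_eq⟩ := hF.exists_opTensor_eq hψ
  replace NV_eq i : opTensor (.id ℂ A) (V i) (opTensor (N i) (.id ℂ B) x) = ψ i.1 i.2 :=
    (opTensor_id_right_left ..).trans (NV_eq i)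
  have tsum_ψ := hF.1.tsum_enorm_decomposition_sq hψ
  have enorm_eq := eq_of_le_of_tsum_le
    (fun i => enorm_sq_le_enorm_sq_iff.2 (NV_eq i ▸ norm_opTensor_id_le (V_le i) _))
    (tsum_ψ ▸ N_sub.tsum_enorm_opTensor_id_sq_le x) (tsum_ψ ▸ enorm_sq_ne_top x)
  refine N_sub.isSimulable (enorm_eq ▸ tsum_ψ) isLocalAlice_single_id (fun i => ?_) fun ω =>
    hF.1.hasSum_ketbra_decomposition (fun k => hP k ω) hψ (hT ω)
  refine .of_contraction_bob (V_le i) hF ?_ (NV_eq i ▸ hPx i.1 (ψ i.1 i.2))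
  exact NV_eq i ▸ enorm_sq_eq_enorm_sq_iff.1 (congrFun enorm_eq i)

theorem IsLOCCRounds.isSimulable {n : ℕ} {I : Ω → Op (HTensor A B) (HTensor A' B')}
    (h : IsLOCCRounds A' B' n A B I) (x : HTensor A B) :
    IsSimulable (2 * n) x fun ω => I ω (ketbra x) := by
  classical
  induction n generalizing A B with
  | zero =>
    obtain ⟨ω₀, E, G, hE, hG, I_tpcp, I_eq, I_zero⟩ := h
    let X : Ω → A →L[ℂ] A := Pi.single ω₀ (.id ℂ A)
    have X_sq a : ∑' ω, ‖X ω a‖ₑ ^ 2 = ‖ContinuousLinearMap.id ℂ A a‖ₑ ^ 2 := by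
      rw [tsum_eq_single ω₀ fun ω hω => by simp [X, hω]]
      simp only [X, Pi.single_eq_same]
    refine ⟨X, fun _ => I ω₀, fun a => (X_sq a).le, ?_, fun ω =>
      ⟨⟨(), E, G, hE, hG, I_tpcp, I_eq, by simp⟩, ?_⟩⟩
    · rw [tsum_enorm_opTensor_id_sq_eq X_sq, opTensor_id, ContinuousLinearMap.id_apply]
    · obtain rfl | hω := eq_or_ne ω ω₀
      · simp [X, opTensor_id]
      · simp [X, hω, I_zero, opTensor_zero_left, ketbra_zero]
  | succ n ih =>
    rcases h with ⟨A₁, _, _, _, F, P, hF, hP, h⟩ | ⟨B₁, _, _, _, F, P, hF, hP, h⟩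
    · exact (hF.isSimulable (fun k => (hP k).isInstrument.isBoundedPositive)
        (fun k => ih (hP k)) fun ω => h ω _).succ
    · exact hF.isSimulable (fun k => (hP k).isInstrument.isBoundedPositive)
        (fun k => ih (hP k)) fun ω => h ω _

end Simulation

section POVM

variable {ι H K : Type*} [NormedAddCommGroup H] [InnerProductSpace ℂ H] [CompleteSpace H]
  [NormedAddCommGroup K] [InnerProductSpace ℂ K] [CompleteSpace K]

theorem hasSum_adjoint_apply_apply {Y : ι → H →L[ℂ] K}
    (h : ∀ x, ∑' i, ‖Y i x‖ₑ ^ 2 = ‖x‖ₑ ^ 2) (x : H) :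
    HasSum (fun i => adjoint (Y i) (Y i x)) x := by
  classical
  have ne_top x : ∑' i, ‖(Y i).toLinearMap x‖ₑ ^ 2 ≠ ∞ := (h x).trans_ne (enorm_sq_ne_top x)
  have norm_column x : ‖column _ ne_top x‖ = ‖x‖ :=
    enorm_sq_eq_enorm_sq_iff.1 ((enorm_column_sq ne_top x).trans (h x))
  let T : H →ₗᵢ[ℂ] lp (fun _ : ι => K) 2 := ⟨column _ ne_top, norm_column⟩
  let T' := T.toContinuousLinearMap
  have adjoint_single i y : adjoint T' (lp.single 2 i y) = adjoint (Y i) y :=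
    ext_inner_right ℂ fun z => by
      rw [ContinuousLinearMap.adjoint_inner_left, ContinuousLinearMap.adjoint_inner_left,
        lp.inner_single_left]
      rfl
  have adjoint_T' : adjoint T' (T' x) = x :=
    DFunLike.congr_fun ((ContinuousLinearMap.norm_map_iff_adjoint_comp_self T').1 T.norm_map) x
  have hasSum_adjoint := (lp.hasSum_single ENNReal.ofNat_ne_top (T' x)).mapL (adjoint T')
  simp only [adjoint_single, adjoint_T'] at hasSum_adjoint
  exact hasSum_adjoint

theorem isPOVM_iff_tsum_enorm_sqrt_sq {M : ι → H →L[ℂ] H} :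
    IsPOVM M ↔ (∀ i, (M i).IsPositive) ∧ ∀ x, ∑' i, ‖CFC.sqrt (M i) x‖ₑ ^ 2 = ‖x‖ₑ ^ 2 := by
  refine and_congr_right fun hM => ⟨fun h x => ?_, fun h x => ?_⟩
  · have quadForm_id := quadForm_eq_tsum hM (S := .id ℂ H) (h x)
    simp only [fun i => quadForm_eq_enorm_sqrt_sq (hM i)] at quadForm_id
    rw [← quadForm_id, quadForm, ContinuousLinearMap.id_apply, inner_self_eq_norm_sq_to_K,
      enorm_sq_eq_ofReal]
    norm_cast
  · convert! hasSum_adjoint_apply_apply h x using 2 with i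
    rw [adjoint_sqrt, ← ContinuousLinearMap.comp_apply, sqrt_comp_sqrt (hM i)]

theorem enorm_sqrt_add_adjoint_comp_self_sq (X S : H →L[ℂ] K) (x : H) :
    ‖CFC.sqrt (adjoint X ∘L X + adjoint S ∘L S) x‖ₑ ^ 2 = ‖X x‖ₑ ^ 2 + ‖S x‖ₑ ^ 2 := by
  have X_pos := X.isPositive_adjoint_comp_self
  have S_pos := S.isPositive_adjoint_comp_self
  rw [← quadForm_eq_enorm_sqrt_sq (X_pos.add S_pos), quadForm, add_apply, inner_add_right,
    Complex.add_re, ENNReal.ofReal_add (Complex.nonneg_iff.1 (X_pos.inner_nonneg_right x)).1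
      (Complex.nonneg_iff.1 (S_pos.inner_nonneg_right x)).1, ← quadForm, ← quadForm,
    quadForm_adjoint_comp_self, quadForm_adjoint_comp_self]

theorem IsSubKraus.exists_isPOVM_ge [Nonempty ι] {X : ι → H →L[ℂ] H} (hX : IsSubKraus X) :
    ∃ M : ι → H →L[ℂ] H, IsPOVM M ∧ ∀ i x, ‖X i x‖ ≤ ‖CFC.sqrt (M i) x‖ := by
  classical
  obtain ⟨S, hS⟩ := hX.exists_isComplement
  let i₀ := Classical.arbitrary ι
  let R : ι → H →L[ℂ] H := Pi.single i₀ S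
  have R_sq x : ∑' i, ‖R i x‖ₑ ^ 2 = ‖S x‖ₑ ^ 2 := by
    rw [tsum_eq_single i₀ fun i hi => by simp [R, hi]]
    simp only [R, Pi.single_eq_same]
  refine ⟨fun i => adjoint (X i) ∘L X i + adjoint (R i) ∘L R i,
    isPOVM_iff_tsum_enorm_sqrt_sq.2 ⟨fun i => (X i).isPositive_adjoint_comp_self.add
      (R i).isPositive_adjoint_comp_self, fun x => ?_⟩, fun i x => ?_⟩
  · simp only [enorm_sqrt_add_adjoint_comp_self_sq]
    rw [ENNReal.tsum_add, R_sq, hS]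
  · rw [← enorm_sq_le_enorm_sq_iff, enorm_sqrt_add_adjoint_comp_self_sq]
    exact le_self_add

end POVM

section Main

universe u v w
variable {Ω : Type w} {A A' : Type u} {B B' : Type v}
  [NormedAddCommGroup A] [InnerProductSpace ℂ A] [CompleteSpace A]
  [NormedAddCommGroup B] [InnerProductSpace ℂ B] [CompleteSpace B]
  [NormedAddCommGroup A'] [InnerProductSpace ℂ A'] [CompleteSpace A']
  [NormedAddCommGroup B'] [InnerProductSpace ℂ B'] [CompleteSpace B']

theorem IsSimulable.exists_isPOVM [Nonempty Ω] {m : ℕ} {x : HTensor A B}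
    {T : Ω → traceClass (HTensor A' B')} (h : IsSimulable m x T) :
    ∃ (M : Ω → A →L[ℂ] A) (C : Ω → Op (HTensor A B) (HTensor A' B')), IsPOVM M ∧ ∀ ω,
      IsLOCCRounds A' B' (m + 1) A B (fun _ : Unit => C ω) ∧
        T ω = C ω (ketbra (opTensor (CFC.sqrt (M ω)) (.id ℂ B) x)) := by
  obtain ⟨X, D, X_sub, X_norm, hD⟩ := h
  obtain ⟨M, M_povm, X_le⟩ := X_sub.exists_isPOVM_ge
  choose V V_le V_eq using fun ω => exists_contraction_comp_eq
    (R := (CFC.sqrt (M ω)).toLinearMap) (T := (X ω).toLinearMap) (X_le ω)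
  replace V_eq ω : opTensor (V ω) (.id ℂ B) (opTensor (CFC.sqrt (M ω)) (.id ℂ B) x) =
      opTensor (X ω) (.id ℂ B) x := by
    rw [opTensor_id_opTensor_id]
    exact congrArg (opTensor · _ x) (ContinuousLinearMap.ext (V_eq ω))
  have sqrt_sub : IsSubKraus fun ω => CFC.sqrt (M ω) := fun a =>
    ((isPOVM_iff_tsum_enorm_sqrt_sq.1 M_povm).2 a).le
  have enorm_le ω : ‖opTensor (X ω) (.id ℂ B) x‖ₑ ^ 2 ≤
      ‖opTensor (CFC.sqrt (M ω)) (.id ℂ B) x‖ₑ ^ 2 := by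
    have h := (isSubKraus_of_norm_le_one (V_le ω)).tsum_enorm_opTensor_id_sq_le
      (opTensor (CFC.sqrt (M ω)) (.id ℂ B) x)
    rwa [tsum_fintype, Fintype.sum_unique, V_eq] at h
  have enorm_eq := eq_of_le_of_tsum_le enorm_le
    (X_norm ▸ sqrt_sub.tsum_enorm_opTensor_id_sq_le x) (X_norm ▸ enorm_sq_ne_top x)
  choose C C_locc C_eq using fun ω =>
    exists_isLOCCRounds_contraction_alice (V_le ω) isLocalAlice_single_id (hD ω).1
  refine ⟨M, C, M_povm, fun ω => ⟨C_locc ω, ?_⟩⟩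
  rw [(hD ω).2, C_eq ω _ (V_eq ω ▸ enorm_sq_eq_enorm_sq_iff.1 (congrFun enorm_eq ω)), V_eq]

end Main

end LOCC

end

theorem mainTheorem5_general.{u, v, w} {A A' : Type u} {B B' : Type v} {Ω : Type w}
    [NormedAddCommGroup A] [InnerProductSpace ℂ A] [CompleteSpace A]
    [NormedAddCommGroup B] [InnerProductSpace ℂ B] [CompleteSpace B]
    [NormedAddCommGroup A'] [InnerProductSpace ℂ A'] [CompleteSpace A']
    [NormedAddCommGroup B'] [InnerProductSpace ℂ B'] [CompleteSpace B']
    {I : Ω → Op (HTensor A B) (HTensor A' B')} (hI : IsLOCCInstrument I) (Φ : HTensor A B) :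
    ∃ (M : Ω → A →L[ℂ] A) (C : Ω → Op (HTensor A B) (HTensor A' B')),
      IsPOVM M ∧
      ∀ ω, IsLOCCOperation (C ω) ∧
        I ω (ketbra Φ) =
          C ω (ketbra (opTensor (CFC.sqrt (M ω)) (ContinuousLinearMap.id ℂ B) Φ)) := by
  obtain ⟨-, n, hn⟩ := hI
  have := hn.nonempty
  obtain ⟨M, C, M_povm, hC⟩ := (hn.isSimulable Φ).exists_isPOVM
  exact ⟨M, C, M_povm, fun ω => ⟨⟨(hC ω).1.isTPCP, _, (hC ω).1⟩, (hC ω).2⟩⟩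

theorem mainTheorem5 {A B Ω : Type*}
    [NormedAddCommGroup A] [InnerProductSpace ℂ A] [CompleteSpace A]
    [NormedAddCommGroup B] [InnerProductSpace ℂ B] [CompleteSpace B]
    (I : Ω → Op (HTensor A B) (HTensor A B)) (hI : IsLOCCInstrument I)
    (Φ : HTensor A B) (hΦ : ‖Φ‖ = 1) :
    ∃ (M : Ω → A →L[ℂ] A) (C : Ω → Op (HTensor A B) (HTensor A B)),
      IsPOVM M ∧
      ∀ ω, IsLOCCOperation (C ω) ∧
        I ω (ketbra Φ) =
          C ω (ketbra (opTensor (CFC.sqrt (M ω)) (ContinuousLinearMap.id ℂ B) Φ)) :=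
  mainTheorem5_general hI Φ
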